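/- For a pair of random variables with joint law $\mu_{XY}$ let $I(X\wedge Y)=\mathbb E\big[\log_2\frac{d\mu_{XY}}{d(\mu_X\times\mu_Y)}(X,Y)\big]$ if $\mu_{XY}\ll\mu_X\times\mu_Y$, and $I(X\wedge Y)=\infty$ otherwise. Let $\mathcal M=\{1,\dots,m\}$; for $A\subseteq\mathcal M$ let $X_A=(X_i)_{i\in A}$, $A^c=\mathcal M\setminus A$, and let $\Sigma_A$, $\Sigma_{AA^c}$ be blocks of the covariance matrix. In each of the following four cases the function $R(\Delta)$, taking values in $[0,\infty]$, is finite-valued, decreasing (i.e. nonincreasing), convex and continuous in $\Delta$ for $\Delta_{\min}<\Delta\le\Delta_{\max}$. (1) *Gaussian memoryless multiple source.* $X_{\mathcal M}\sim\mathcal N(0,\Sigma)$ with $\Sigma$ positive definite, $\emptyset\ne A\subseteq\mathcal M$, $G_A=I+\Sigma_A^{-1}\Sigma_{AA^c}\Sigma_{AA^c}^T\Sigma_A^{-1}$, $\Delta_{\min}=\sum_{i\in A^c}(\mathbb E[X_i^2]-\mathbb E[X_iX_A^T]\Sigma_A^{-1}\mathbb E[X_AX_i])$, $\Delta_{\max}=\sum_{i\in\mathcal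 M}\mathbb E[X_i^2]$, and $R(\Delta)$ is the infimum of $I(X_A\wedge Y_A)$ over all joint laws with $\mu_{X_AY_A}\ll\mu_{X_A}\times\mu_{Y_A}$ and $\mathbb E[(X_A-Y_A)^TG_A(X_A-Y_A)]\le\Delta-\Delta_{\min}$. (2) *Gaussian memoryless field.* $(X_u)_{u\in[0,1]}$ is a zero-mean Gaussian process with bounded measurable covariance function $r(s,t)=\mathbb E[X_sX_t]$ and positive-definite finite-dimensional covariance matrices, $A\subset[0,1]$ is finite and nonempty, $G_{A}=\Sigma_A^{-1}\big(\int_0^1\mathbb E[X_AX_u]\mathbb E[X_uX_A^T]\,du\big)\Sigma_A^{-1}$, $\Delta_{\min}=\int_0^1(\mathbb E[X_u^2]-\mathbb E[X_uX_A^T]\Sigma_A^{-1}\mathbb E[X_AX_u])\,du$, $\Delta_{\max}=\int_0^1\mathbb E[X_u^2]\,du$, and $R(\Delta)$ is defined as in (1) with these $G_A$ and $\Delta_{\min}$. For (3) and (4) let $\Theta$ be a nonempty compact set of positive-definite $m\times m$ matrices $\tau$, with $X_{\mathcal M}\sim\mathcal N(0,\tau)$ given $\theta=\tau$; let $\emptyset\ne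 A\subseteq\mathcal M$, let $\tau_A$ be the $A\times A$ block of $\tau$, $\Theta_1=\{\tau_A:\tau\in\Theta\}$, and $\Lambda(\tau_1)=\{\tau\in\Theta:\tau_A=\tau_1\}$ for $\tau_1\in\Theta_1$. (3) *Bayesian setting.* $\theta$ is a $\Theta$-valued random variable with an arbitrary known Borel law, $\theta_1=\theta_A$, and a regular conditional distribution of $\theta$ given $\theta_1=\tau_1$ is fixed that is carried by $\Lambda(\tau_1)$ for every $\tau_1\in\Theta_1$. Let $\rho^{\mathcal B}(\delta,\tau_1)$ be the infimum of $I(X_A\wedge Y_{\mathcal M}\mid\theta_1=\tau_1)$ over all channels $\mu_{Y_{\mathcal M}\mid X_A,\theta_1=\tau_1}$ (so that $(\theta,X_{\mathcal M})$, $(\theta_1,X_A)$, $Y_{\mathcal M}$ form a Markov chain) with $\mu_{X_AY_{\mathcal M}|\theta_1=\tau_1}\ll\mu_{X_A|\theta_1=\tau_1}\times\mu_{Y_{\mathcal M}|\theta_1=\tau_1}$ and $\mathbb E[\|X_{\mathcal M}-Y_{\mathcal M}\|^2\mid\theta_1=\tau_1]\le\delta$. Then $$R(\Delta)=\inf_{\{\Delta_{\tau_1}\}:\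 \mathbb E[\Delta_{\theta_1}]\le\Delta}\ \sup_{\tau_1\in\Theta_1}\rho^{\mathcal B}(\Delta_{\tau_1},\tau_1),$$ the infimum being over measurable families $\Delta_{\tau_1}\ge0$; $\Delta_{\min}=\mathbb E\big[\min_{y}\mathbb E[\sum_{i\in A^c}(X_i-y_i)^2\mid X_A,\theta_1]\big]$ and $\Delta_{\max}=\sum_{i\in\mathcal M}\mathbb E[X_i^2]$. (4) *NonBayesian setting.* For $\tau_1\in\Theta_1$ let $\rho^{n\mathcal B}(\delta,\tau_1)$ be the infimum of $I(X_A\wedge Y_{\mathcal M}\mid\theta_1=\tau_1)$, where $X_A\sim\mathcal N(0,\tau_1)$, over all channels $\mu_{Y_{\mathcal M}\mid X_A,\theta_1=\tau_1}$ with $\mu_{X_AY_{\mathcal M}|\theta_1=\tau_1}\ll\mu_{X_A|\theta_1=\tau_1}\times\mu_{Y_{\mathcal M}|\theta_1=\tau_1}$ and $\mathbb E[\|X_{\mathcal M}-Y_{\mathcal M}\|^2\mid\theta=\tau]\le\delta$ for every $\tau\in\Lambda(\tau_1)$. Then $R(\Delta)=\sup_{\tau_1\in\Theta_1}\rho^{n\mathcal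 B}(\Delta,\tau_1)$, $$\Delta_{\min}=\sup_{\tau_1\in\Theta_1}\ \inf_{\mu_{Y_{A^c}|X_A,\theta_1=\tau_1}}\ \sup_{\tau\in\Lambda(\tau_1)}\ \sum_{i\in A^c}\mathbb E[(X_i-Y_i)^2\mid\theta=\tau],\qquad \Delta_{\max}=\max_{\tau\in\Theta}\sum_{i\in\mathcal M}\mathbb E[X_i^2\mid\theta=\tau].$$ -/

import Mathlib

open MeasureTheory ProbabilityTheory InformationTheory Matrix Set
open scoped ENNReal MatrixOrder

namespace SampledGaussian

/-- Real matrices carry the product σ-algebra of their entries. -/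
instance matrixMeasurableSpace {m n : Type*} : MeasurableSpace (Matrix m n ℝ) :=
  inferInstanceAs (MeasurableSpace (m → n → ℝ))

instance matrixBorelSpace {m n : Type*} [Finite m] [Finite n] : BorelSpace (Matrix m n ℝ) :=
  inferInstanceAs (BorelSpace (m → n → ℝ))

instance matrixPolishSpace {m n : Type*} [Finite m] [Finite n] : PolishSpace (Matrix m n ℝ) :=
  inferInstanceAs (PolishSpace (m → n → ℝ))

/-- The subvector `x_A` of `x`. -/
def sub {ι : Type*} (A : Finset ι) (x : EuclideanSpace ℝ ι) : EuclideanSpace ℝ A :=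
  WithLp.toLp 2 (fun i : A => x i)

theorem measurable_sub {ι : Type*} (A : Finset ι) : Measurable (sub A) := by
  unfold sub
  fun_prop

/-- The block `S_{AB}` of a matrix `S`. -/
def block {ι : Type*} (S : Matrix ι ι ℝ) (A B : Finset ι) : Matrix A B ℝ :=
  S.submatrix (fun i : A => (i : ι)) (fun j : B => (j : ι))

/-- The mutual information `I(X ∧ Y)`, in bits, of a pair `(X, Y)` with joint law `μ`.
It is `∞` if `μ` is not absolutely continuous with respect to the product of its marginals. -/
noncomputable def mutualInfo {α β : Type*} [MeasurableSpace α] [MeasurableSpace β]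
    (μ : Measure (α × β)) : ℝ≥0∞ :=
  klDiv μ (μ.fst.prod μ.snd) / ENNReal.ofReal (Real.log 2)

/-- `R : ℝ → [0, ∞]` is finite-valued, decreasing (nonincreasing), convex and continuous
on the interval `(a, b]`. -/
structure IsRateDistortionShaped (R : ℝ → ℝ≥0∞) (a b : ℝ) : Prop where
  finite : ∀ D ∈ Ioc a b, R D ≠ ∞
  decreasing : AntitoneOn (fun D => (R D).toReal) (Ioc a b)
  convex : ConvexOn ℝ (Ioc a b) (fun D => (R D).toReal)
  continuous : ContinuousOn (fun D => (R D).toReal) (Ioc a b)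

/-! ### Known distribution -/

/-- The minimal mutual information between `X ∼ P` and a reproduction `Y`, over all joint laws with
`μ_{XY} ≪ μ_X × μ_Y` and `E[(X - Y)ᵀ G (X - Y)] ≤ D`. -/
noncomputable def weightedRDf {κ : Type*} [Fintype κ] (P : Measure (EuclideanSpace ℝ κ))
    (G : Matrix κ κ ℝ) (D : ℝ) : ℝ≥0∞ :=
  ⨅ μ ∈ {μ : Measure (EuclideanSpace ℝ κ × EuclideanSpace ℝ κ) |
      μ.fst = P ∧ μ ≪ μ.fst.prod μ.snd ∧
      ∫⁻ p, ENNReal.ofReal ((p.1 - p.2).ofLp ⬝ᵥ G *ᵥ (p.1 - p.2).ofLp) ∂μ ≤ ENNReal.ofReal D},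
    mutualInfo μ

section Source

variable {ι : Type*} [Fintype ι] [DecidableEq ι]

/-- The weight matrix `G_A = I + Σ_A⁻¹ Σ_{AAᶜ} Σ_{AAᶜ}ᵀ Σ_A⁻¹`. -/
noncomputable def weightGMMS (S : Matrix ι ι ℝ) (A : Finset ι) : Matrix A A ℝ :=
  1 + (block S A A)⁻¹ * block S A Aᶜ * (block S A Aᶜ)ᵀ * (block S A A)⁻¹

/-- `Δ_{min,A} = ∑_{i ∈ Aᶜ} (E[X_i²] - E[X_i X_Aᵀ] Σ_A⁻¹ E[X_A X_i])`. -/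
noncomputable def dminGMMS (S : Matrix ι ι ℝ) (A : Finset ι) : ℝ :=
  ∑ i ∈ Aᶜ, (S i i - (fun a : A => S i a) ⬝ᵥ (block S A A)⁻¹ *ᵥ (fun a : A => S a i))

/-- The single-letter expression for the sampling rate distortion function of the Gaussian
memoryless multiple source with covariance matrix `S`, sampled at `A`. -/
noncomputable def srdfGMMS (S : Matrix ι ι ℝ) (A : Finset ι) (D : ℝ) : ℝ≥0∞ :=
  weightedRDf ((multivariateGaussian 0 S).map (sub A)) (weightGMMS S A) (D - dminGMMS S A)

end Source

/-! ### Gaussian field on `[0, 1]` -/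

section Field

variable {Ω : Type*} [MeasurableSpace Ω]

/-- The covariance function `r(s, t) = E[X_s X_t]` of a zero-mean process on `[0, 1]`. -/
noncomputable def covFun (X : unitInterval → Ω → ℝ) (P : Measure Ω) (s t : unitInterval) : ℝ :=
  ∫ ω, X s ω * X t ω ∂P

/-- The covariance matrix of the samples of the process at the points of `A`. -/
noncomputable def covMatrix (X : unitInterval → Ω → ℝ) (P : Measure Ω)
    (A : Finset unitInterval) : Matrix A A ℝ :=
  Matrix.of fun a b : A => covFun X P a b

/-- `X` is a zero-mean Gaussian process on `[0, 1]` with a bounded measurable covariance function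
(which is then integrable on the unit square) and positive-definite finite-dimensional covariance
matrices. -/
structure IsGaussianField (X : unitInterval → Ω → ℝ) (P : Measure Ω) : Prop where
  gaussian : IsGaussianProcess X P
  mean_zero : ∀ u, ∫ ω, X u ω ∂P = 0
  cov_measurable : Measurable (fun p : unitInterval × unitInterval => covFun X P p.1 p.2)
  cov_bounded : ∃ C : ℝ, ∀ s t, |covFun X P s t| ≤ C
  cov_posDef : ∀ B : Finset unitInterval, (covMatrix X P B).PosDef

/-- The weight matrix `G_{A,I} = Σ_A⁻¹ (∫_I E[X_A X_u] E[X_u X_Aᵀ] du) Σ_A⁻¹`. -/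
noncomputable def weightGMF (X : unitInterval → Ω → ℝ) (P : Measure Ω)
    (A : Finset unitInterval) : Matrix A A ℝ :=
  (covMatrix X P A)⁻¹ *
    (Matrix.of fun a b : A => ∫ u : unitInterval, covFun X P a u * covFun X P u b) *
    (covMatrix X P A)⁻¹

/-- `Δ_{min,A} = ∫_I (E[X_u²] - E[X_u X_Aᵀ] Σ_A⁻¹ E[X_A X_u]) du`. -/
noncomputable def dminGMF (X : unitInterval → Ω → ℝ) (P : Measure Ω)
    (A : Finset unitInterval) : ℝ :=
  ∫ u : unitInterval, (covFun X P u u -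
    (fun a : A => covFun X P u a) ⬝ᵥ (covMatrix X P A)⁻¹ *ᵥ (fun a : A => covFun X P a u))

/-- `Δ_max = ∫_I E[X_u²] du`. -/
noncomputable def dmaxGMF (X : unitInterval → Ω → ℝ) (P : Measure Ω) : ℝ :=
  ∫ u : unitInterval, covFun X P u u

/-- The single-letter expression for the sampling rate distortion function of the Gaussian
memoryless field with generic process `X`, sampled at `A`. -/
noncomputable def srdfGMF (X : unitInterval → Ω → ℝ) (P : Measure Ω)
    (A : Finset unitInterval) (D : ℝ) : ℝ≥0∞ :=
  weightedRDf (P.map fun ω => WithLp.toLp 2 (fun a : A => X a ω)) (weightGMF X P A)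
    (D - dminGMF X P A)

end Field

/-! ### Universal setting -/

section Universal

variable {ι : Type*} [Fintype ι] [DecidableEq ι]

theorem measurable_matrixSqrt : Measurable (fun S : Matrix ι ι ℝ => CFC.sqrt S) := by
  intro s hs
  have hpsd : MeasurableSet {S : Matrix ι ι ℝ | S.PosSemidef} := by
    have h : {S : Matrix ι ι ℝ | S.PosSemidef} =
        {S | Sᴴ = S} ∩ ⋂ x : ι → ℝ, {S | 0 ≤ star x ⬝ᵥ S *ᵥ x} := by
      ext S
      simp [Matrix.posSemidef_iff_dotProduct_mulVec, Matrix.IsHermitian]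
    rw [h]
    refine IsClosed.measurableSet (IsClosed.inter (isClosed_eq (by fun_prop) (by fun_prop))
      (isClosed_iInter fun x => isClosed_le (by fun_prop) (by fun_prop)))
  have hzero : ∀ S : Matrix ι ι ℝ, ¬ S.PosSemidef → CFC.sqrt S = 0 := by
    intro S hS
    rw [CFC.sqrt, cfcₙ_apply_of_not_predicate]
    change ¬ (S - 0).PosSemidef
    simpa
  have himg : MeasurableSet
      ((fun B : Matrix ι ι ℝ => B * B) '' (s ∩ {S : Matrix ι ι ℝ | S.PosSemidef})) := by
    refine (hs.inter hpsd).image_of_continuousOn_injOn (by fun_prop) ?_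
    intro B hB C hC h
    have hB' : (0 : Matrix ι ι ℝ) ≤ B := hB.2.nonneg
    have hC' : (0 : Matrix ι ι ℝ) ≤ C := hC.2.nonneg
    have h' : B * B = C * C := h
    rw [← CFC.sqrt_mul_self B hB', h', CFC.sqrt_mul_self C hC']
  have hpre : (fun S : Matrix ι ι ℝ => CFC.sqrt S) ⁻¹' s =
      ((fun B : Matrix ι ι ℝ => B * B) '' (s ∩ {S : Matrix ι ι ℝ | S.PosSemidef})) ∪
        ({S : Matrix ι ι ℝ | S.PosSemidef}ᶜ ∩ {_S | (0 : Matrix ι ι ℝ) ∈ s}) := by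
    ext S
    by_cases hS : S.PosSemidef
    · constructor
      · intro h
        refine Or.inl ⟨CFC.sqrt S, ⟨h, ?_⟩, CFC.sqrt_mul_sqrt_self S hS.nonneg⟩
        exact Matrix.nonneg_iff_posSemidef.1 (CFC.sqrt_nonneg S)
      · rintro (⟨B, ⟨hBs, hB⟩, rfl⟩ | h)
        · have hB' : (0 : Matrix ι ι ℝ) ≤ B := Matrix.PosSemidef.nonneg hB
          simpa [CFC.sqrt_mul_self B hB'] using hBs
        · exact absurd hS h.1
    · constructor
      · intro h
        refine Or.inr ⟨hS, ?_⟩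
        simpa [hzero S hS] using h
      · rintro (⟨B, ⟨hBs, hB⟩, rfl⟩ | h)
        · refine absurd ?_ hS
          have hBB : (Bᴴ * B).PosSemidef := Matrix.posSemidef_conjTranspose_mul_self B
          rwa [(show Bᴴ = B from hB.1)] at hBB
        · simpa [hzero S hS] using h.2
  rw [hpre]
  exact himg.union (hpsd.compl.inter (MeasurableSet.const _))

theorem measurable_multivariateGaussian :
    Measurable (fun S : Matrix ι ι ℝ => multivariateGaussian (0 : EuclideanSpace ℝ ι) S) := by
  have hF : Measurable (fun p : Matrix ι ι ℝ × EuclideanSpace ℝ ι =>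
      (0 : EuclideanSpace ℝ ι) + toEuclideanCLM (𝕜 := ℝ) (CFC.sqrt p.1) p.2) := by
    have h1 : Measurable (fun p : Matrix ι ι ℝ × EuclideanSpace ℝ ι =>
        (CFC.sqrt p.1, p.2)) := (measurable_matrixSqrt.comp measurable_fst).prodMk measurable_snd
    have h2 : Continuous (fun p : Matrix ι ι ℝ × EuclideanSpace ℝ ι =>
        (0 : EuclideanSpace ℝ ι) + WithLp.toLp 2 (p.1 *ᵥ p.2.ofLp)) := by
      fun_prop
    exact h2.measurable.comp h1
  refine Measure.measurable_of_measurable_coe _ fun s hs => ?_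
  have : ∀ S : Matrix ι ι ℝ, multivariateGaussian (0 : EuclideanSpace ℝ ι) S s =
      stdGaussian (EuclideanSpace ℝ ι) (Prod.mk S ⁻¹' ((fun p : Matrix ι ι ℝ × EuclideanSpace ℝ ι =>
      (0 : EuclideanSpace ℝ ι) + toEuclideanCLM (𝕜 := ℝ) (CFC.sqrt p.1) p.2) ⁻¹' s)) := by
    intro S
    rw [multivariateGaussian, Measure.map_apply (by fun_prop) hs]
    rfl
  simp_rw [this]
  exact measurable_measure_prodMk_left (hF hs)

/-- The law `N(0, τ)` of `X_M` given `θ = τ`, as a Markov kernel. -/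
noncomputable def gaussianKernel : Kernel (Matrix ι ι ℝ) (EuclideanSpace ℝ ι) where
  toFun S := multivariateGaussian 0 S
  measurable' := measurable_multivariateGaussian

instance isMarkovKernel_gaussianKernel :
    IsMarkovKernel (gaussianKernel : Kernel (Matrix ι ι ℝ) (EuclideanSpace ℝ ι)) :=
  ⟨fun S => by
    change IsProbabilityMeasure (multivariateGaussian (0 : EuclideanSpace ℝ ι) S)
    infer_instance⟩

/-- `Θ₁`, the set of covariance matrices of `X_A`. -/
def marginalSet (Θ : Set (Matrix ι ι ℝ)) (A : Finset ι) : Set (Matrix A A ℝ) :=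
  (fun τ => block τ A A) '' Θ

/-- The ambiguity atom `Λ(τ₁)`. -/
def atom (Θ : Set (Matrix ι ι ℝ)) (A : Finset ι) (τ₁ : Matrix A A ℝ) : Set (Matrix ι ι ℝ) :=
  {τ ∈ Θ | block τ A A = τ₁}

/-- The law of `θ₁` when `θ ∼ ν`. -/
noncomputable def marginalPrior (ν : Measure (Matrix ι ι ℝ)) (A : Finset ι) :
    Measure (Matrix A A ℝ) :=
  ν.map fun τ => block τ A A

/-- `κ` is a regular conditional distribution of `θ ∼ ν` given `θ₁`, carried by the atom `Λ(τ₁)`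
for every `τ₁ ∈ Θ₁`. -/
structure IsPosterior (Θ : Set (Matrix ι ι ℝ)) (ν : Measure (Matrix ι ι ℝ)) (A : Finset ι)
    (κ : Kernel (Matrix A A ℝ) (Matrix ι ι ℝ)) : Prop where
  disintegrates : marginalPrior ν A ⊗ₘ κ = ν.map fun τ => (block τ A A, τ)
  carried : ∀ τ₁ ∈ marginalSet Θ A, κ τ₁ (atom Θ A τ₁)ᶜ = 0

/-- The joint law of `(X_M, Y_M)` when `X_M ∼ P` and `Y_M` is produced from `X_A` by `W`. -/
noncomputable def sourceReproduction (P : Measure (EuclideanSpace ℝ ι)) (A : Finset ι)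
    (W : Kernel (EuclideanSpace ℝ A) (EuclideanSpace ℝ ι)) :
    Measure (EuclideanSpace ℝ ι × EuclideanSpace ℝ ι) :=
  P ⊗ₘ W.comap (sub A) (measurable_sub A)

/-- `E[‖X_M - Y_M‖²]` when `X_M ∼ P` and `Y_M` is produced from `X_A` by `W`. -/
noncomputable def meanDistortion (P : Measure (EuclideanSpace ℝ ι)) (A : Finset ι)
    (W : Kernel (EuclideanSpace ℝ A) (EuclideanSpace ℝ ι)) : ℝ≥0∞ :=
  ∫⁻ p, ENNReal.ofReal (‖p.1 - p.2‖ ^ 2) ∂(sourceReproduction P A W)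

/-- The law of `X_M` given `θ₁ = τ₁`, when `κ` is the conditional law of `θ` given `θ₁`. -/
noncomputable def condLaw (A : Finset ι) (κ : Kernel (Matrix A A ℝ) (Matrix ι ι ℝ))
    (τ₁ : Matrix A A ℝ) : Measure (EuclideanSpace ℝ ι) :=
  (gaussianKernel ∘ₖ κ) τ₁

instance isProbabilityMeasure_condLaw (A : Finset ι) (κ : Kernel (Matrix A A ℝ) (Matrix ι ι ℝ))
    [IsMarkovKernel κ] (τ₁ : Matrix A A ℝ) : IsProbabilityMeasure (condLaw A κ τ₁) := by
  unfold condLaw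
  infer_instance

/-- `ρ_A^B(δ, τ₁)`: the minimal `I(X_A ∧ Y_M | θ₁ = τ₁)` over the reproductions `Y_M` that
depend on `(θ, X_M)` only through `(θ₁, X_A)` and satisfy
`E[‖X_M - Y_M‖² | θ₁ = τ₁] ≤ δ`. -/
noncomputable def rhoBayes (A : Finset ι) (κ : Kernel (Matrix A A ℝ) (Matrix ι ι ℝ))
    (δ : ℝ) (τ₁ : Matrix A A ℝ) : ℝ≥0∞ :=
  ⨅ W ∈ {W : Kernel (EuclideanSpace ℝ A) (EuclideanSpace ℝ ι) |
      IsMarkovKernel W ∧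
      ((condLaw A κ τ₁).map (sub A) ⊗ₘ W) ≪
        ((condLaw A κ τ₁).map (sub A) ⊗ₘ W).fst.prod ((condLaw A κ τ₁).map (sub A) ⊗ₘ W).snd ∧
      meanDistortion (condLaw A κ τ₁) A W ≤ ENNReal.ofReal δ},
    mutualInfo ((condLaw A κ τ₁).map (sub A) ⊗ₘ W)

/-- The single-letter expression for the Bayesian universal sampling rate distortion function:
the infimum over families `{Δ_{τ₁}}` with `E[Δ_{θ₁}] ≤ Δ` of
`sup_{τ₁ ∈ Θ₁} ρ_A^B(Δ_{τ₁}, τ₁)`. -/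
noncomputable def usrdfBayes (Θ : Set (Matrix ι ι ℝ)) (ν : Measure (Matrix ι ι ℝ))
    (A : Finset ι) (κ : Kernel (Matrix A A ℝ) (Matrix ι ι ℝ)) (D : ℝ) : ℝ≥0∞ :=
  ⨅ δ ∈ {δ : Matrix A A ℝ → ℝ | Measurable δ ∧ (∀ τ₁, 0 ≤ δ τ₁) ∧
      Integrable δ (marginalPrior ν A) ∧ ∫ τ₁, δ τ₁ ∂(marginalPrior ν A) ≤ D},
    ⨆ τ₁ ∈ marginalSet Θ A, rhoBayes A κ (δ τ₁) τ₁

/-- `E[min_y E[∑_{i ∈ Aᶜ} (X_i - y_i)² | X_A, θ₁ = τ₁] | θ₁ = τ₁]`. -/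
noncomputable def dminBayesAt (A : Finset ι) (κ : Kernel (Matrix A A ℝ) (Matrix ι ι ℝ))
    [IsMarkovKernel κ] (τ₁ : Matrix A A ℝ) : ℝ≥0∞ :=
  ∫⁻ xA, ⨅ y : EuclideanSpace ℝ (Aᶜ : Finset ι),
    ∫⁻ z, ENNReal.ofReal (‖z - y‖ ^ 2) ∂(condDistrib (sub Aᶜ) (sub A) (condLaw A κ τ₁) xA)
    ∂((condLaw A κ τ₁).map (sub A))

/-- `Δ_{min,A}` in the Bayesian setting. -/
noncomputable def dminBayes (ν : Measure (Matrix ι ι ℝ)) (A : Finset ι)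
    (κ : Kernel (Matrix A A ℝ) (Matrix ι ι ℝ)) [IsMarkovKernel κ] : ℝ :=
  (∫⁻ τ₁, dminBayesAt A κ τ₁ ∂(marginalPrior ν A)).toReal

/-- `Δ_max = ∑_i E[X_i²]` in the Bayesian setting. -/
noncomputable def dmaxBayes (ν : Measure (Matrix ι ι ℝ)) : ℝ :=
  ∫ τ, τ.trace ∂ν

/-- `ρ_A^{nB}(δ, τ₁)`: the infimum of `I(X_A ∧ Y_M | θ₁ = τ₁)` over the reproductions `Y_M`
generated from `X_A` by a channel depending only on `τ₁`, such that
`E[‖X_M - Y_M‖² | θ = τ] ≤ δ` for all `τ ∈ Λ(τ₁)`. -/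
noncomputable def rhoNonBayes (Θ : Set (Matrix ι ι ℝ)) (A : Finset ι)
    (δ : ℝ) (τ₁ : Matrix A A ℝ) : ℝ≥0∞ :=
  ⨅ W ∈ {W : Kernel (EuclideanSpace ℝ A) (EuclideanSpace ℝ ι) |
      IsMarkovKernel W ∧
      (multivariateGaussian 0 τ₁ ⊗ₘ W) ≪
        (multivariateGaussian 0 τ₁ ⊗ₘ W).fst.prod (multivariateGaussian 0 τ₁ ⊗ₘ W).snd ∧
      ∀ τ ∈ atom Θ A τ₁, meanDistortion (multivariateGaussian 0 τ) A W ≤ ENNReal.ofReal δ},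
    mutualInfo (multivariateGaussian 0 τ₁ ⊗ₘ W)

/-- The single-letter expression for the nonBayesian universal sampling rate distortion
function. -/
noncomputable def usrdfNonBayes (Θ : Set (Matrix ι ι ℝ)) (A : Finset ι) (D : ℝ) : ℝ≥0∞ :=
  ⨆ τ₁ ∈ marginalSet Θ A, rhoNonBayes Θ A D τ₁

/-- The infimum, over all channels from `X_A` to `Y_{Aᶜ}`, of
`sup_{τ ∈ Λ(τ₁)} ∑_{i ∈ Aᶜ} E[(X_i - Y_i)² | θ = τ]`. -/
noncomputable def dminNonBayesAt (Θ : Set (Matrix ι ι ℝ)) (A : Finset ι)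
    (τ₁ : Matrix A A ℝ) : ℝ≥0∞ :=
  ⨅ V ∈ {V : Kernel (EuclideanSpace ℝ A) (EuclideanSpace ℝ (Aᶜ : Finset ι)) | IsMarkovKernel V},
    ⨆ τ ∈ atom Θ A τ₁,
      ∫⁻ x, ∫⁻ y, ENNReal.ofReal (‖sub Aᶜ x - y‖ ^ 2) ∂(V (sub A x)) ∂(multivariateGaussian 0 τ)

/-- `Δ_{min,A}` in the nonBayesian setting. -/
noncomputable def dminNonBayes (Θ : Set (Matrix ι ι ℝ)) (A : Finset ι) : ℝ :=
  (⨆ τ₁ ∈ marginalSet Θ A, dminNonBayesAt Θ A τ₁).toReal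

/-- `Δ_max` in the nonBayesian setting: the largest `∑_i E[X_i² | θ = τ]`, `τ ∈ Θ`. -/
noncomputable def dmaxNonBayes (Θ : Set (Matrix ι ι ℝ)) : ℝ :=
  sSup ((fun τ : Matrix ι ι ℝ => τ.trace) '' Θ)

end Universal

end SampledGaussian

/-! Each rate function is shown to be finite, nonincreasing and convex on the whole open ray `(a,
∞)`, with `a` the minimal distortion. A convex function on an open interval is continuous, so
restriction gives the shape on `(a, b]` for every `b`, and the particular value of `Δ_max` plays no
role (`IsRateDistortionShaped.of_Ioi`). Monotonicity is immediate: a larger allowance enlarges the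
feasible set.

Convexity rests on the joint convexity of divergence (`klDiv_add_le`). For two joint laws with the
same first marginal, the product of marginals is linear under mixing, hence mutual information is
convex along the mixture, while distortion is linear in it. Mixing near-minimisers gives convexity
of the basic infimum. In the nonBayesian case the supremum over `τ₁` preserves it; in the Bayesian
case the allowance families are mixed as well.

Finiteness uses a reproduction with finitely many values: its mutual information is bounded by a
constant depending only on the number of values (`mutualInfo_le_of_finite_range`). One quantizer
degrades the squared error by an amount controlled by fourth moments (`exists_quantizer`), and these
are uniformly bounded on a compact set of covariances. In the universal settings `X_A` is copied,
`X_{Aᶜ}` is estimated nearly optimally, and the result is quantized; the same quantizer serves every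
`τ₁`, so the supremum stays finite. The Bayesian case also needs the allowances to be measurable in
`τ₁`, which comes from a countable family of estimators dense in `L²` of every law at once. -/

namespace SampledGaussian

/-! ### Convexity of divergence and mutual information. -/

/-- The Kullback-Leibler divergence is jointly subadditive. -/
theorem klDiv_add_le {α : Type*} [MeasurableSpace α] (μ₀ μ₁ ν₀ ν₁ : Measure α)
    [IsFiniteMeasure μ₀] [IsFiniteMeasure μ₁] [IsFiniteMeasure ν₀] [IsFiniteMeasure ν₁] :
    klDiv (μ₀ + μ₁) (ν₀ + ν₁) ≤ klDiv μ₀ ν₀ + klDiv μ₁ ν₁ := by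
  by_cases h₀ : μ₀ ≪ ν₀
  swap; · simp [klDiv_of_not_ac h₀]
  by_cases h₁ : μ₁ ≪ ν₁
  swap; · simp [klDiv_of_not_ac h₁]
  have n₀ : ν₀ ≪ ν₀ + ν₁ := Measure.AbsolutelyContinuous.rfl.add_right ν₁
  have n₁ : ν₁ ≪ ν₀ + ν₁ := by
    rw [add_comm]; exact Measure.AbsolutelyContinuous.rfl.add_right ν₀
  have hac : μ₀ + μ₁ ≪ ν₀ + ν₁ := Measure.AbsolutelyContinuous.add_left (h₀.trans n₀) (h₁.trans n₁)
  -- All three integrals are rewritten over `ν₀ + ν₁`, so that the claim becomes a pointwise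
  -- inequality of densities.
  rw [klDiv_eq_lintegral_klFun_of_ac h₀, klDiv_eq_lintegral_klFun_of_ac h₁,
    klDiv_eq_lintegral_klFun_of_ac hac, ← lintegral_rnDeriv_mul n₀ (by fun_prop),
    ← lintegral_rnDeriv_mul n₁ (by fun_prop), ← lintegral_add_left (by fun_prop)]
  refine lintegral_mono_ae ?_
  filter_upwards [Measure.rnDeriv_add' μ₀ μ₁ (ν₀ + ν₁), Measure.rnDeriv_add' ν₀ ν₁ (ν₀ + ν₁),
    Measure.rnDeriv_self (ν₀ + ν₁), Measure.rnDeriv_mul_rnDeriv (κ := ν₀ + ν₁) h₀,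
    Measure.rnDeriv_mul_rnDeriv (κ := ν₀ + ν₁) h₁, Measure.rnDeriv_ne_top μ₀ (ν₀ + ν₁),
    Measure.rnDeriv_ne_top μ₁ (ν₀ + ν₁), Measure.rnDeriv_ne_top ν₀ (ν₀ + ν₁),
    Measure.rnDeriv_ne_top ν₁ (ν₀ + ν₁)] with x e₁ e₂ e₃ e₄ e₅ t₀ t₁ s₀ s₁
  rw [e₃] at e₂
  simp only [Pi.add_apply, Pi.mul_apply] at e₁ e₂ e₄ e₅
  -- The densities of `ν₀` and `ν₁` are convex weights, and the density of `μ₀ + μ₁` is the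
  -- corresponding average of `dμ₀/dν₀` and `dμ₁/dν₁`; convexity of `klFun` then applies.
  have hone : (ν₀.rnDeriv (ν₀ + ν₁) x).toReal + (ν₁.rnDeriv (ν₀ + ν₁) x).toReal = 1 := by
    rw [← ENNReal.toReal_add s₀ s₁, ← e₂]; simp
  rw [e₁, ENNReal.toReal_add t₀ t₁, ← e₄, ← e₅, ENNReal.toReal_mul, ENNReal.toReal_mul]
  generalize ν₀.rnDeriv (ν₀ + ν₁) x = g₀ at *
  generalize ν₁.rnDeriv (ν₀ + ν₁) x = g₁ at *
  generalize (μ₀.rnDeriv ν₀ x) = f₀ at *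
  generalize (μ₁.rnDeriv ν₁ x) = f₁ at *
  have hc := convexOn_klFun.2 (mem_Ici.2 (ENNReal.toReal_nonneg (a := f₀)))
    (mem_Ici.2 (ENNReal.toReal_nonneg (a := f₁))) (ENNReal.toReal_nonneg (a := g₀))
    (ENNReal.toReal_nonneg (a := g₁)) hone
  simp only [smul_eq_mul] at hc
  calc _ ≤ ENNReal.ofReal (g₀.toReal * klFun f₀.toReal + g₁.toReal * klFun f₁.toReal) := by
        apply ENNReal.ofReal_le_ofReal
        rwa [mul_comm f₀.toReal, mul_comm f₁.toReal]
    _ = _ := by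
        rw [ENNReal.ofReal_add, ENNReal.ofReal_mul ENNReal.toReal_nonneg,
          ENNReal.ofReal_mul ENNReal.toReal_nonneg, ENNReal.ofReal_toReal s₀,
          ENNReal.ofReal_toReal s₁]
        · exact mul_nonneg ENNReal.toReal_nonneg (klFun_nonneg ENNReal.toReal_nonneg)
        · exact mul_nonneg ENNReal.toReal_nonneg (klFun_nonneg ENNReal.toReal_nonneg)

/-- Mutual information is convex along mixtures of joint laws with the same first marginal. -/
theorem mutualInfo_mixture_le {α β : Type*} [MeasurableSpace α] [MeasurableSpace β]
    (μ₀ μ₁ : Measure (α × β)) [IsFiniteMeasure μ₀] [IsFiniteMeasure μ₁] (h : μ₀.fst = μ₁.fst)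
    {s t : ℝ≥0∞} (hst : s + t = 1) :
    mutualInfo (s • μ₀ + t • μ₁) ≤ s * mutualInfo μ₀ + t * mutualInfo μ₁ := by
  have hs : s ≠ ∞ := fun h => by simp [h] at hst
  have ht : t ≠ ∞ := fun h => by simp [h] at hst
  lift s to NNReal using hs
  lift t to NNReal using ht
  have hfst : ((s : ℝ≥0∞) • μ₀ + (t : ℝ≥0∞) • μ₁).fst = μ₀.fst := by
    rw [Measure.fst_add, Measure.fst, Measure.fst, Measure.map_smul, Measure.map_smul,
      ← Measure.fst, ← Measure.fst, ← h, ← add_smul, hst, one_smul]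
  have hsnd : ((s : ℝ≥0∞) • μ₀ + (t : ℝ≥0∞) • μ₁).snd = s • μ₀.snd + t • μ₁.snd := by
    rw [Measure.snd_add, Measure.snd, Measure.snd, Measure.map_smul, Measure.map_smul]
    rfl
  -- Only the shared first marginal makes the product of marginals, in general bilinear, linear
  -- along the mixture.
  have hprod : ((s : ℝ≥0∞) • μ₀ + (t : ℝ≥0∞) • μ₁).fst.prod
      ((s : ℝ≥0∞) • μ₀ + (t : ℝ≥0∞) • μ₁).snd =
      s • (μ₀.fst.prod μ₀.snd) + t • (μ₁.fst.prod μ₁.snd) := by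
    rw [hfst, hsnd, Measure.prod_add, ← h]
    congr 1
    · exact Measure.prod_smul_right _
    · exact Measure.prod_smul_right _
  unfold mutualInfo
  rw [hprod, ← mul_div_assoc, ← mul_div_assoc, ← ENNReal.add_div, ← klDiv_smul_same,
    ← klDiv_smul_same]
  gcongr
  exact klDiv_add_le (s • μ₀) (t • μ₁) _ _

/-- Both weights must be nonzero: each second marginal has to be dominated by the mixed one. -/
theorem mixture_absolutelyContinuous {α β : Type*} [MeasurableSpace α] [MeasurableSpace β]
    {μ₀ μ₁ : Measure (α × β)} [IsFiniteMeasure μ₀] [IsFiniteMeasure μ₁] (h : μ₀.fst = μ₁.fst)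
    (h₀ : μ₀ ≪ μ₀.fst.prod μ₀.snd) (h₁ : μ₁ ≪ μ₁.fst.prod μ₁.snd)
    {s t : ℝ≥0∞} (hs0 : s ≠ 0) (ht0 : t ≠ 0) (hst : s + t = 1) :
    s • μ₀ + t • μ₁ ≪ (s • μ₀ + t • μ₁).fst.prod (s • μ₀ + t • μ₁).snd := by
  have hfst : (s • μ₀ + t • μ₁).fst = μ₀.fst := by
    rw [Measure.fst_add, Measure.fst, Measure.fst, Measure.map_smul, Measure.map_smul,
      ← Measure.fst, ← Measure.fst, ← h, ← add_smul, hst, one_smul]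
  have hsnd : (s • μ₀ + t • μ₁).snd = s • μ₀.snd + t • μ₁.snd := by
    rw [Measure.snd_add, Measure.snd, Measure.snd, Measure.map_smul, Measure.map_smul]
    rfl
  rw [hfst, hsnd]
  have hs : s ≠ ∞ := fun h => by simp [h] at hst
  have ht : t ≠ ∞ := fun h => by simp [h] at hst
  have := Measure.smul_finite μ₀.snd hs
  have := Measure.smul_finite μ₁.snd ht
  refine Measure.AbsolutelyContinuous.add_left
    (Measure.AbsolutelyContinuous.smul_left (h₀.trans ?_) s)
    (Measure.AbsolutelyContinuous.smul_left (h₁.trans ?_) t)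
  · refine Measure.AbsolutelyContinuous.rfl.prod ?_
    exact (Measure.absolutelyContinuous_smul hs0).add_right _
  · rw [h]
    refine Measure.AbsolutelyContinuous.rfl.prod ?_
    rw [add_comm]
    exact (Measure.absolutelyContinuous_smul ht0).add_right _

/-! ### Mutual information of a finitely valued reproduction. -/

section FiniteRange

variable {α β : Type*} [MeasurableSpace α] [MeasurableSpace β] [MeasurableSingletonClass β]
  (μ : Measure (α × β)) [IsProbabilityMeasure μ] (F : Finset β)

/-- On the fibre over `y` the product measure is the first marginal scaled by the mass of `y`, and
the joint law is at most that marginal. If `y` has mass zero, the left side vanishes. -/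
theorem measure_inter_fiber_le {S : Set (α × β)} (hS : MeasurableSet S) (y : β) :
    μ (S ∩ Prod.snd ⁻¹' {y}) ≤
      (μ.snd {y})⁻¹ * (μ.fst.prod μ.snd) (S ∩ Prod.snd ⁻¹' {y}) := by
  by_cases hy : μ.snd {y} = 0
  · refine le_trans (le_of_eq ?_) zero_le
    refine measure_mono_null inter_subset_right ?_
    rwa [Measure.snd_apply (measurableSet_singleton y)] at hy
  have hset : S ∩ Prod.snd ⁻¹' {y} = ((fun x => (x, y)) ⁻¹' S) ×ˢ {y} := by
    ext ⟨a, b⟩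
    simp only [mem_inter_iff, mem_preimage, mem_singleton_iff, mem_prod]
    constructor <;> (rintro ⟨h, rfl⟩; exact ⟨h, rfl⟩)
  rw [hset, Measure.prod_prod, mul_comm (μ.fst _), ← mul_assoc, ENNReal.inv_mul_cancel hy
    (measure_ne_top _ _), one_mul, Measure.fst_apply (hS.preimage (by fun_prop))]
  exact measure_mono fun p hp => hp.1

variable {μ F}

theorem measure_le_withDensity_of_finite_range (hF : ∀ᵐ p ∂μ, p.2 ∈ F) :
    μ ≤ (μ.fst.prod μ.snd).withDensity
      (fun p => ∑ y ∈ F, (Prod.snd ⁻¹' {y}).indicator (fun _ => (μ.snd {y})⁻¹) p) := by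
  refine Measure.le_iff.2 fun S hS => ?_
  have hm : ∀ y : β, MeasurableSet (Prod.snd ⁻¹' {y} : Set (α × β)) :=
    fun y => measurable_snd (measurableSet_singleton y)
  rw [withDensity_apply _ hS, lintegral_finsetSum _
    (fun y _ => measurable_const.indicator (hm y))]
  calc μ S = μ (⋃ y ∈ F, S ∩ Prod.snd ⁻¹' {y}) := by
        refine measure_congr ?_
        filter_upwards [hF] with p hp
        refine propext ⟨fun h => ?_, fun h => ?_⟩
        · exact mem_biUnion hp ⟨h, rfl⟩
        · obtain ⟨y, _, hy⟩ := mem_iUnion₂.1 h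
          exact hy.1
    _ ≤ ∑ y ∈ F, μ (S ∩ Prod.snd ⁻¹' {y}) := measure_biUnion_finset_le _ _
    _ ≤ _ := by
        refine Finset.sum_le_sum fun y _ => (measure_inter_fiber_le μ hS y).trans (le_of_eq ?_)
        rw [lintegral_indicator_const (hm y), Measure.restrict_apply (hm y), inter_comm]

theorem absolutelyContinuous_of_finite_range (hF : ∀ᵐ p ∂μ, p.2 ∈ F) :
    μ ≪ μ.fst.prod μ.snd :=
  (measure_le_withDensity_of_finite_range hF).absolutelyContinuous.trans
    (withDensity_absolutelyContinuous _ _)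

/-- If the second component takes values in a finite set `F`, then the mutual information is
bounded in terms of the cardinality of `F` only. -/
theorem mutualInfo_le_of_finite_range (hF : ∀ᵐ p ∂μ, p.2 ∈ F) :
    mutualInfo μ ≤ (1 + F.card) / ENNReal.ofReal (Real.log 2) := by
  have hac := absolutelyContinuous_of_finite_range hF
  unfold mutualInfo
  gcongr
  rw [klDiv_eq_lintegral_klFun_of_ac hac]
  set ν := μ.fst.prod μ.snd
  set g : α × β → ℝ≥0∞ :=
    fun p => ∑ y ∈ F, (Prod.snd ⁻¹' {y}).indicator (fun _ => (μ.snd {y})⁻¹) p with hg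
  have hm : ∀ y : β, MeasurableSet (Prod.snd ⁻¹' {y} : Set (α × β)) :=
    fun y => measurable_snd (measurableSet_singleton y)
  have hgm : Measurable g :=
    Finset.measurable_fun_sum _ fun y _ => measurable_const.indicator (hm y)
  have hle : μ.rnDeriv ν ≤ᵐ[ν] g := by
    refine ae_le_of_forall_setLIntegral_le_of_sigmaFinite (Measure.measurable_rnDeriv _ _) ?_
    intro s hs _
    refine (Measure.setLIntegral_rnDeriv_le s).trans ?_
    rw [← withDensity_apply _ hs]
    exact measure_le_withDensity_of_finite_range hF s
  -- Since `log r ≤ r`, `klFun r ≤ 1 + r * r`. One factor `r` is bounded by `g`; the other turns the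
  -- integral over `ν` into one over `μ`.
  calc ∫⁻ p, ENNReal.ofReal (klFun (μ.rnDeriv ν p).toReal) ∂ν
      ≤ ∫⁻ p, (1 + μ.rnDeriv ν p * g p) ∂ν := by
        refine lintegral_mono_ae ?_
        filter_upwards [hle, Measure.rnDeriv_ne_top μ ν] with p hp htop
        calc ENNReal.ofReal (klFun (μ.rnDeriv ν p).toReal)
            ≤ ENNReal.ofReal (1 + (μ.rnDeriv ν p).toReal * (μ.rnDeriv ν p).toReal) := by
              apply ENNReal.ofReal_le_ofReal
              have h0 : 0 ≤ (μ.rnDeriv ν p).toReal := ENNReal.toReal_nonneg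
              rw [klFun_apply]
              have := mul_le_mul_of_nonneg_left (Real.log_le_self h0) h0
              linarith
          _ = 1 + μ.rnDeriv ν p * μ.rnDeriv ν p := by
              rw [ENNReal.ofReal_add zero_le_one (mul_self_nonneg _),
                ENNReal.ofReal_mul ENNReal.toReal_nonneg, ENNReal.ofReal_toReal htop,
                ENNReal.ofReal_one]
          _ ≤ _ := by gcongr
    _ = 1 + ∫⁻ p, g p ∂μ := by
        rw [lintegral_add_left measurable_const, lintegral_rnDeriv_mul hac hgm.aemeasurable]
        simp [ν]
    _ ≤ 1 + F.card := by
        gcongr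
        rw [hg, lintegral_finsetSum _ (fun y _ => measurable_const.indicator (hm y))]
        calc _ ≤ ∑ y ∈ F, (1 : ℝ≥0∞) := by
              refine Finset.sum_le_sum fun y _ => ?_
              rw [lintegral_indicator_const (hm y),
                ← Measure.snd_apply (measurableSet_singleton y)]
              -- Each atom contributes at most one; for a null atom, `∞ * 0 = 0`.
              exact ENNReal.inv_mul_le_one _
          _ = _ := by simp

end FiniteRange

theorem finiteRange_bound_ne_top {β : Type*} (F : Finset β) :
    (1 + F.card : ℝ≥0∞) / ENNReal.ofReal (Real.log 2) ≠ ∞ := by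
  refine ENNReal.div_ne_top (by simp) ?_
  simpa using Real.log_pos one_lt_two

/-! ### Reduction to finiteness and convexity. -/

/-- A rate function that is finite, nonincreasing and convex on `(a, ∞)` has the required shape on
`(a, b]` for every `b`. -/
theorem IsRateDistortionShaped.of_Ioi {R : ℝ → ℝ≥0∞} {a : ℝ} (b : ℝ)
    (hfin : ∀ D, a < D → R D ≠ ∞) (hanti : Antitone R)
    (hconv : ∀ x y, a < x → a < y → ∀ s t : ℝ, 0 < s → 0 < t → s + t = 1 →
      R (s * x + t * y) ≤ ENNReal.ofReal s * R x + ENNReal.ofReal t * R y) :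
    IsRateDistortionShaped R a b := by
  -- Working on the open ray makes `b` an interior point, so continuity at the right endpoint comes
  -- for free.
  have hc : ConvexOn ℝ (Ioi a) (fun D => (R D).toReal) := by
    refine convexOn_iff_forall_pos.2 ⟨convex_Ioi a, fun x hx y hy s t hs ht hst => ?_⟩
    have hx' := hfin x hx
    have hy' := hfin y hy
    simp only [smul_eq_mul]
    have h := ENNReal.toReal_mono (by finiteness) (hconv x y hx hy s t hs ht hst)
    rwa [ENNReal.toReal_add (by finiteness) (by finiteness), ENNReal.toReal_mul,
      ENNReal.toReal_mul, ENNReal.toReal_ofReal hs.le, ENNReal.toReal_ofReal ht.le] at h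
  have hsub : Ioc a b ⊆ Ioi a := fun x hx => hx.1
  exact ⟨fun D hD => hfin D hD.1,
    fun x hx y _ hxy => ENNReal.toReal_mono (hfin x hx.1) (hanti hxy),
    hc.subset hsub (convex_Ioc a b), (hc.continuousOn isOpen_Ioi).mono hsub⟩

/-- A convexity inequality for two infima follows from the one for near-minimisers. -/
theorem le_mul_add_mul_of_forall_lt {z a b s t : ℝ≥0∞} (hs : s ≠ ∞) (ht : t ≠ ∞)
    (hs0 : s ≠ 0) (ht0 : t ≠ 0)
    (h : ∀ u v, a < u → b < v → z ≤ s * u + t * v) : z ≤ s * a + t * b := by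
  rcases eq_or_ne a ∞ with rfl | ha
  · simp [ENNReal.mul_top hs0]
  rcases eq_or_ne b ∞ with rfl | hb
  · simp [ENNReal.mul_top ht0]
  refine ENNReal.le_of_forall_pos_le_add fun ε hε _ => ?_
  have hε' : (ε : ℝ≥0∞) / (s + t) ≠ 0 := by
    refine (ENNReal.div_pos ?_ (by finiteness)).ne'
    exact_mod_cast hε.ne'
  refine (h (a + ε / (s + t)) (b + ε / (s + t)) (ENNReal.lt_add_right ha hε')
    (ENNReal.lt_add_right hb hε')).trans (le_of_eq ?_)
  rw [mul_add, mul_add, add_add_add_comm, ← add_mul, ENNReal.mul_div_cancel (by simp [hs0])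
    (by finiteness)]


/-! ### Quantization and fourth moments. -/

/-- A finite-valued quantizer that degrades the squared error by a small amount, uniformly. -/
theorem exists_quantizer {E : Type*} [NormedAddCommGroup E] [ProperSpace E]
    [MeasurableSpace E] [BorelSpace E] {η : ℝ} (hη : 0 < η) :
    ∃ Q : SimpleFunc E E, ∀ x y : E,
      ‖x - Q y‖ ^ 2 ≤ (1 + η) * ‖x - y‖ ^ 2 + η * (1 + ‖x‖ ^ 4) := by
  -- `ε` is the mesh inside a ball of radius `r`, sized to absorb the remainder in Young's
  -- inequality; `r` is so large that `‖x‖ > r / 2` forces `‖x‖ ^ 2 ≤ η * ‖x‖ ^ 4`.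
  obtain ⟨ε, hε, hεη⟩ : ∃ ε : ℝ, 0 < ε ∧ (1 + η⁻¹) * ε ^ 2 ≤ η := by
    refine ⟨Real.sqrt (η / (1 + η⁻¹)), by positivity, ?_⟩
    rw [Real.sq_sqrt (by positivity)]
    exact le_of_eq (by field_simp)
  obtain ⟨r, hr, hrη⟩ : ∃ r : ℝ, 0 < r ∧ 4 ≤ η * r ^ 2 := by
    refine ⟨Real.sqrt (4 / η), by positivity, ?_⟩
    rw [Real.sq_sqrt (by positivity)]
    exact le_of_eq (by field_simp)
  let e := TopologicalSpace.denseSeq E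
  have hcov : Metric.closedBall (0 : E) r ⊆ ⋃ k, Metric.ball (e k) ε := fun y _ => by
    obtain ⟨k, hk⟩ := (TopologicalSpace.denseRange_denseSeq E).exists_dist_lt y hε
    exact mem_iUnion.2 ⟨k, hk⟩
  obtain ⟨T, hT⟩ := (isCompact_closedBall (0 : E) r).elim_finite_subcover _
    (fun _ => Metric.isOpen_ball) hcov
  have hm : MeasurableSet (Metric.closedBall (0 : E) r) := Metric.isClosed_closedBall.measurableSet
  refine ⟨SimpleFunc.piecewise _ hm (SimpleFunc.nearestPt e (T.sup id)) (SimpleFunc.const E 0),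
    fun x y => ?_⟩
  rw [SimpleFunc.piecewise_apply]
  split_ifs with hy
  · obtain ⟨k, hkT, hk⟩ := mem_iUnion₂.1 (hT hy)
    have hnear : ‖y - SimpleFunc.nearestPt e (T.sup id) y‖ ≤ ε := by
      have h := SimpleFunc.edist_nearestPt_le e y (Finset.le_sup (f := id) hkT)
      rw [edist_dist, edist_dist, ENNReal.ofReal_le_ofReal_iff dist_nonneg] at h
      rw [← dist_eq_norm, dist_comm]
      refine h.trans ?_
      rw [dist_comm]
      exact (Metric.mem_ball.1 hk).le
    generalize SimpleFunc.nearestPt e (T.sup id) y = q at *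
    have h1 : ‖x - q‖ ≤ ‖x - y‖ + ‖y - q‖ := by simpa using norm_add_le (x - y) (y - q)
    have h2 : ‖x - q‖ ^ 2 ≤ (‖x - y‖ + ε) ^ 2 := by gcongr; linarith
    have h3 : (‖x - y‖ + ε) ^ 2 ≤ (1 + η) * ‖x - y‖ ^ 2 + (1 + η⁻¹) * ε ^ 2 := by
      have h4 : 0 ≤ η⁻¹ * (η * ‖x - y‖ - ε) ^ 2 := by positivity
      have h5 : η⁻¹ * (η * ‖x - y‖ - ε) ^ 2 =
          η * ‖x - y‖ ^ 2 - 2 * ‖x - y‖ * ε + η⁻¹ * ε ^ 2 := by field_simp; ring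
      nlinarith
    have h6 : 0 ≤ η * ‖x‖ ^ 4 := by positivity
    linarith
  · rw [mem_closedBall_zero_iff, not_le] at hy
    rw [SimpleFunc.const_apply, sub_zero]
    -- Here `y` lies outside the ball and is sent to `0`. If `‖x‖ ≤ r / 2`, then `0` is no farther
    -- from `x` than `y` is; otherwise the quartic term pays.
    rcases le_or_gt ‖x‖ (r / 2) with hx | hx
    · have h1 : ‖x‖ ≤ ‖x - y‖ := by
        have := norm_sub_norm_le y x
        rw [norm_sub_rev] at this
        linarith
      have h2 : ‖x‖ ^ 2 ≤ ‖x - y‖ ^ 2 := by gcongr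
      have h3 : 0 ≤ η * ‖x - y‖ ^ 2 := by positivity
      have h4 : 0 ≤ η * (1 + ‖x‖ ^ 4) := by positivity
      linarith
    · have h1 : (r / 2) ^ 2 ≤ ‖x‖ ^ 2 := by gcongr
      have h2 : 1 ≤ η * ‖x‖ ^ 2 := by nlinarith
      have h3 : ‖x‖ ^ 2 ≤ η * ‖x‖ ^ 4 := by nlinarith [sq_nonneg ‖x‖]
      have h4 : 0 ≤ (1 + η) * ‖x - y‖ ^ 2 := by positivity
      linarith

theorem exists_mem_lt_of_biInf_lt {α : Type*} {s : Set α} {f : α → ℝ≥0∞} {c : ℝ≥0∞}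
    (h : ⨅ i ∈ s, f i < c) : ∃ i ∈ s, f i < c := by
  simpa [iInf_lt_iff] using h

/-- The moment `E[1 + ‖X‖⁴]`. -/
noncomputable def quarticMoment {E : Type*} [NormedAddCommGroup E] [MeasurableSpace E]
    (P : Measure E) : ℝ≥0∞ :=
  ∫⁻ x, ENNReal.ofReal (1 + ‖x‖ ^ 4) ∂P

theorem quarticMoment_ne_top_of_isGaussian {E : Type*} [NormedAddCommGroup E] [NormedSpace ℝ E]
    [MeasurableSpace E] [BorelSpace E] [CompleteSpace E] [SecondCountableTopology E]
    (P : Measure E) [IsGaussian P] : quarticMoment P ≠ ∞ := by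
  have h := (IsGaussian.memLp_id P 4 (by simp)).integrable_norm_pow (p := 4) (by simp)
  exact ((integrable_const 1).add h).lintegral_lt_top.ne

theorem dotProduct_mulVec_le {κ : Type*} [Fintype κ] (G : Matrix κ κ ℝ)
    (v : EuclideanSpace ℝ κ) :
    v.ofLp ⬝ᵥ G *ᵥ v.ofLp ≤ (∑ i, ∑ j, |G i j|) * ‖v‖ ^ 2 := by
  rw [dotProduct, Finset.sum_mul]
  refine Finset.sum_le_sum fun i _ => ?_
  rw [mulVec, dotProduct, Finset.mul_sum, Finset.sum_mul]
  refine Finset.sum_le_sum fun j _ => ?_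
  have hi : |v i| ≤ ‖v‖ := PiLp.norm_apply_le v i
  have hj : |v j| ≤ ‖v‖ := PiLp.norm_apply_le v j
  calc v i * (G i j * v j) ≤ |v i * (G i j * v j)| := le_abs_self _
    _ = |G i j| * (|v i| * |v j|) := by rw [abs_mul, abs_mul]; ring
    _ ≤ |G i j| * (‖v‖ * ‖v‖) := by gcongr
    _ = _ := by ring

/-! ### Known distribution: weighted quadratic distortion. -/

section WeightedRDf

variable {κ : Type*} [Fintype κ] (P : Measure (EuclideanSpace ℝ κ)) (G : Matrix κ κ ℝ)

theorem weightedRDf_antitone : Antitone (weightedRDf P G) := by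
  intro x y hxy
  refine le_iInf₂ fun μ hμ => iInf₂_le μ ⟨hμ.1, hμ.2.1, hμ.2.2.trans ?_⟩
  exact ENNReal.ofReal_le_ofReal hxy

/-- The reproduction is the quantized source itself, whose weighted distortion is at most a small
multiple of the fourth moment. -/
theorem weightedRDf_ne_top [IsProbabilityMeasure P] (hP : quarticMoment P ≠ ∞) {D : ℝ}
    (hD : 0 < D) : weightedRDf P G D ≠ ∞ := by
  obtain ⟨C, hC0, hC⟩ : ∃ C : ℝ, 0 ≤ C ∧
      ∀ v : EuclideanSpace ℝ κ, v.ofLp ⬝ᵥ G *ᵥ v.ofLp ≤ C * ‖v‖ ^ 2 :=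
    ⟨_, by positivity, dotProduct_mulVec_le G⟩
  set m := (quarticMoment P).toReal
  have hm : 0 ≤ m := ENNReal.toReal_nonneg
  -- With this `η`, `C * η * m ≤ D`; the `+ 1` keeps the denominator positive.
  obtain ⟨Q, hQ⟩ := exists_quantizer (E := EuclideanSpace ℝ κ) (η := D / (C * m + 1))
    (by positivity)
  have hmeas : Measurable (fun x : EuclideanSpace ℝ κ => (x, Q x)) :=
    measurable_id.prodMk Q.measurable
  set μ := P.map (fun x => (x, Q x)) with hμ
  have : IsProbabilityMeasure μ := Measure.isProbabilityMeasure_map hmeas.aemeasurable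
  have hF : ∀ᵐ p ∂μ, p.2 ∈ Q.range := by
    exact (ae_map_iff hmeas.aemeasurable (measurable_snd Q.range.measurableSet)).2
      (Filter.Eventually.of_forall fun x => Q.mem_range_self x)
  refine ne_top_of_le_ne_top (finiteRange_bound_ne_top Q.range)
    ((iInf₂_le μ ⟨?_, absolutelyContinuous_of_finite_range hF, ?_⟩).trans
      (mutualInfo_le_of_finite_range hF))
  · rw [hμ, Measure.fst_map_prodMk Q.measurable, Measure.map_id']
  · have hGm : Measurable (fun p : EuclideanSpace ℝ κ × EuclideanSpace ℝ κ =>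
        ENNReal.ofReal ((p.1 - p.2).ofLp ⬝ᵥ G *ᵥ (p.1 - p.2).ofLp)) := by
      refine ENNReal.measurable_ofReal.comp (Continuous.measurable ?_)
      fun_prop
    rw [hμ, lintegral_map hGm hmeas]
    calc _ ≤ ∫⁻ x, ENNReal.ofReal (C * (D / (C * m + 1))) * ENNReal.ofReal (1 + ‖x‖ ^ 4) ∂P := by
          refine lintegral_mono fun x => ?_
          rw [← ENNReal.ofReal_mul (by positivity)]
          refine ENNReal.ofReal_le_ofReal ((hC _).trans ?_)
          rw [mul_assoc]
          refine mul_le_mul_of_nonneg_left ?_ hC0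
          simpa using hQ x x
      _ = ENNReal.ofReal (C * (D / (C * m + 1)) * m) := by
          rw [lintegral_const_mul' _ _ ENNReal.ofReal_ne_top, 
            ENNReal.ofReal_mul (q := m) (by positivity), ENNReal.ofReal_toReal hP, quarticMoment]
      _ ≤ _ := by
          refine ENNReal.ofReal_le_ofReal ?_
          rw [mul_div_assoc', div_mul_eq_mul_div, div_le_iff₀ (by positivity)]
          nlinarith

theorem weightedRDf_convex [IsProbabilityMeasure P] {x y s t : ℝ} (hx : 0 < x) (hy : 0 < y)
    (hs : 0 < s) (ht : 0 < t) (hst : s + t = 1) :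
    weightedRDf P G (s * x + t * y) ≤
      ENNReal.ofReal s * weightedRDf P G x + ENNReal.ofReal t * weightedRDf P G y := by
  have hs' : ENNReal.ofReal s ≠ 0 := by simpa using hs
  have ht' : ENNReal.ofReal t ≠ 0 := by simpa using ht
  have hst' : ENNReal.ofReal s + ENNReal.ofReal t = 1 := by
    rw [← ENNReal.ofReal_add hs.le ht.le, hst, ENNReal.ofReal_one]
  refine le_mul_add_mul_of_forall_lt (by simp) (by simp) hs' ht' fun u v hu hv => ?_
  obtain ⟨μ₀, ⟨hf₀, hac₀, hd₀⟩, hi₀⟩ := exists_mem_lt_of_biInf_lt hu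
  obtain ⟨μ₁, ⟨hf₁, hac₁, hd₁⟩, hi₁⟩ := exists_mem_lt_of_biInf_lt hv
  have : IsFiniteMeasure μ₀ := ⟨by rw [← Measure.fst_univ, hf₀]; simp⟩
  have : IsFiniteMeasure μ₁ := ⟨by rw [← Measure.fst_univ, hf₁]; simp⟩
  refine (iInf₂_le (ENNReal.ofReal s • μ₀ + ENNReal.ofReal t • μ₁) ⟨?_,
    mixture_absolutelyContinuous (hf₀.trans hf₁.symm) hac₀ hac₁ hs' ht' hst', ?_⟩).trans
    ((mutualInfo_mixture_le μ₀ μ₁ (hf₀.trans hf₁.symm) hst').trans ?_)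
  · gcongr
  · rw [Measure.fst_add, Measure.fst, Measure.fst, Measure.map_smul, Measure.map_smul,
      ← Measure.fst, ← Measure.fst, hf₀, hf₁, ← add_smul, hst', one_smul]
  · rw [lintegral_add_measure, lintegral_smul_measure, lintegral_smul_measure,
      ENNReal.ofReal_add (by positivity) (by positivity), ENNReal.ofReal_mul hs.le,
      ENNReal.ofReal_mul ht.le, smul_eq_mul, smul_eq_mul]
    gcongr

theorem isRateDistortionShaped_weightedRDf [IsProbabilityMeasure P] (hP : quarticMoment P ≠ ∞)
    (a b : ℝ) : IsRateDistortionShaped (fun D => weightedRDf P G (D - a)) a b := by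
  refine IsRateDistortionShaped.of_Ioi b (fun D hD => weightedRDf_ne_top P G hP (sub_pos.2 hD))
    (fun x y hxy => weightedRDf_antitone P G (sub_le_sub_right hxy a)) ?_
  intro x y hx hy s t hs ht hst
  have h : s * x + t * y - a = s * (x - a) + t * (y - a) := by
    linear_combination a * hst
  simp only [h]
  exact weightedRDf_convex P G (sub_pos.2 hx) (sub_pos.2 hy) hs ht hst

end WeightedRDf

theorem exists_clm_eq_sub {ι : Type*} [Fintype ι] (A : Finset ι) :
    ∃ L : EuclideanSpace ℝ ι →L[ℝ] EuclideanSpace ℝ A, ∀ x, L x = sub A x :=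
  let L : EuclideanSpace ℝ ι →ₗ[ℝ] EuclideanSpace ℝ A :=
    { toFun := sub A, map_add' := fun _ _ => rfl, map_smul' := fun _ _ => rfl }
  ⟨L.toContinuousLinearMap, fun _ => rfl⟩

theorem isRateDistortionShaped_srdfGMMS {ι : Type*} [Fintype ι] [DecidableEq ι]
    (S : Matrix ι ι ℝ) (A : Finset ι) (b : ℝ) :
    IsRateDistortionShaped (srdfGMMS S A) (dminGMMS S A) b := by
  obtain ⟨L, hL⟩ := exists_clm_eq_sub A
  have : IsGaussian ((multivariateGaussian 0 S).map (sub A)) := by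
    rw [← funext hL]
    infer_instance
  exact isRateDistortionShaped_weightedRDf _ _ (quarticMoment_ne_top_of_isGaussian _) _ b

theorem isRateDistortionShaped_srdfGMF {Ω : Type*} [MeasurableSpace Ω] {P : Measure Ω}
    {X : unitInterval → Ω → ℝ} (hX : IsGaussianField X P) (A : Finset unitInterval) (b : ℝ) :
    IsRateDistortionShaped (srdfGMF X P A) (dminGMF X P A) b := by
  have h : HasGaussianLaw (fun ω => WithLp.toLp 2 (fun a : A => X a ω)) P :=
    (hX.gaussian.hasGaussianLaw A).toLp_pi 2
  have := h.isGaussian_map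
  exact isRateDistortionShaped_weightedRDf _ _ (quarticMoment_ne_top_of_isGaussian _) _ b


/-! ### Channels: mixtures and a common rate problem. -/

section

section Mixture

variable {α β : Type*} [MeasurableSpace α] [MeasurableSpace β]

/-- The pointwise combination `s V + t W` of two kernels. -/
noncomputable def mixKernel (s t : ℝ≥0∞) (V W : Kernel α β) : Kernel α β where
  toFun x := s • V x + t • W x
  measurable' := by
    refine Measure.measurable_of_measurable_coe _ fun S hS => ?_
    simp only [Measure.add_apply, Measure.smul_apply, smul_eq_mul]
    exact ((V.measurable_coe hS).const_mul s).add ((W.measurable_coe hS).const_mul t)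

theorem mixKernel_apply (s t : ℝ≥0∞) (V W : Kernel α β) (x : α) :
    mixKernel s t V W x = s • V x + t • W x := rfl

theorem isMarkovKernel_mixKernel {s t : ℝ≥0∞} (hst : s + t = 1) (V W : Kernel α β)
    [IsMarkovKernel V] [IsMarkovKernel W] : IsMarkovKernel (mixKernel s t V W) :=
  ⟨fun x => ⟨by simp [mixKernel_apply, hst]⟩⟩

/-- Mixing channels under a fixed input mixes joint laws with the same first marginal, the situation
in which mutual information is convex. -/
theorem compProd_mixKernel {s t : ℝ≥0∞} (hst : s + t = 1) (P : Measure α) [SFinite P]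
    (V W : Kernel α β) [IsMarkovKernel V] [IsMarkovKernel W] :
    P ⊗ₘ mixKernel s t V W = s • (P ⊗ₘ V) + t • (P ⊗ₘ W) := by
  have := isMarkovKernel_mixKernel hst V W
  ext S hS
  have hV : Measurable fun a => V a (Prod.mk a ⁻¹' S) := Kernel.measurable_kernel_prodMk_left hS
  have hW : Measurable fun a => W a (Prod.mk a ⁻¹' S) := Kernel.measurable_kernel_prodMk_left hS
  rw [Measure.add_apply, Measure.smul_apply, Measure.smul_apply, Measure.compProd_apply hS,
    Measure.compProd_apply hS, Measure.compProd_apply hS]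
  simp only [mixKernel_apply, Measure.add_apply, Measure.smul_apply, smul_eq_mul]
  rw [lintegral_add_left (hV.const_mul s), lintegral_const_mul s hV, lintegral_const_mul t hW]

end Mixture

variable {ι : Type*} [Fintype ι]

theorem measurable_ofReal_norm_sub_sq {E : Type*} [NormedAddCommGroup E] [MeasurableSpace E]
    [BorelSpace E] [SecondCountableTopology E] :
    Measurable (fun p : E × E => ENNReal.ofReal (‖p.1 - p.2‖ ^ 2)) := by
  fun_prop

theorem meanDistortion_eq (P : Measure (EuclideanSpace ℝ ι)) [SFinite P] (A : Finset ι)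
    (W : Kernel (EuclideanSpace ℝ A) (EuclideanSpace ℝ ι)) [IsMarkovKernel W] :
    meanDistortion P A W = ∫⁻ x, ∫⁻ y, ENNReal.ofReal (‖x - y‖ ^ 2) ∂(W (sub A x)) ∂P := by
  rw [meanDistortion, sourceReproduction,
    Measure.lintegral_compProd measurable_ofReal_norm_sub_sq]
  rfl

theorem meanDistortion_mixKernel {s t : ℝ≥0∞} (hst : s + t = 1)
    (P : Measure (EuclideanSpace ℝ ι)) [SFinite P] (A : Finset ι)
    (V W : Kernel (EuclideanSpace ℝ A) (EuclideanSpace ℝ ι)) [IsMarkovKernel V]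
    [IsMarkovKernel W] :
    meanDistortion P A (mixKernel s t V W) =
      s * meanDistortion P A V + t * meanDistortion P A W := by
  have h : (mixKernel s t V W).comap (sub A) (measurable_sub A) =
      mixKernel s t (V.comap (sub A) (measurable_sub A)) (W.comap (sub A) (measurable_sub A)) := rfl
  rw [meanDistortion, sourceReproduction, h, compProd_mixKernel hst, lintegral_add_measure,
    lintegral_smul_measure, lintegral_smul_measure]
  rfl

/-- The minimal mutual information between `X_A ∼ P` and a reproduction `Y_M` obtained from `X_A`
through a channel meeting the distortion constraint under each of the laws in `L`. -/
noncomputable def channelRDf (A : Finset ι) (P : Measure (EuclideanSpace ℝ A))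
    (L : Set (Measure (EuclideanSpace ℝ ι))) (δ : ℝ) : ℝ≥0∞ :=
  ⨅ W ∈ {W : Kernel (EuclideanSpace ℝ A) (EuclideanSpace ℝ ι) |
      IsMarkovKernel W ∧ (P ⊗ₘ W) ≪ (P ⊗ₘ W).fst.prod (P ⊗ₘ W).snd ∧
      ∀ μ ∈ L, meanDistortion μ A W ≤ ENNReal.ofReal δ},
    mutualInfo (P ⊗ₘ W)

section ChannelRDf

variable (A : Finset ι) (P : Measure (EuclideanSpace ℝ A))
  (L : Set (Measure (EuclideanSpace ℝ ι)))

theorem channelRDf_antitone : Antitone (channelRDf A P L) := by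
  intro x y hxy
  exact le_iInf₂ fun W hW => iInf₂_le W ⟨hW.1, hW.2.1,
    fun μ hμ => (hW.2.2 μ hμ).trans (ENNReal.ofReal_le_ofReal hxy)⟩

theorem channelRDf_convex [IsProbabilityMeasure P] (hL : ∀ μ ∈ L, IsProbabilityMeasure μ)
    {x y s t : ℝ} (hx : 0 ≤ x) (hy : 0 ≤ y) (hs : 0 < s) (ht : 0 < t) (hst : s + t = 1) :
    channelRDf A P L (s * x + t * y) ≤
      ENNReal.ofReal s * channelRDf A P L x + ENNReal.ofReal t * channelRDf A P L y := by
  have hs' : ENNReal.ofReal s ≠ 0 := by simpa using hs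
  have ht' : ENNReal.ofReal t ≠ 0 := by simpa using ht
  have hst' : ENNReal.ofReal s + ENNReal.ofReal t = 1 := by
    rw [← ENNReal.ofReal_add hs.le ht.le, hst, ENNReal.ofReal_one]
  refine le_mul_add_mul_of_forall_lt (by simp) (by simp) hs' ht' fun u v hu hv => ?_
  obtain ⟨V, ⟨hV, hac₀, hd₀⟩, hi₀⟩ := exists_mem_lt_of_biInf_lt hu
  obtain ⟨W, ⟨hW, hac₁, hd₁⟩, hi₁⟩ := exists_mem_lt_of_biInf_lt hv
  have hfst : (P ⊗ₘ V).fst = (P ⊗ₘ W).fst := by simp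
  have hmix := compProd_mixKernel hst' P V W
  refine (iInf₂_le (mixKernel (ENNReal.ofReal s) (ENNReal.ofReal t) V W)
    ⟨isMarkovKernel_mixKernel hst' V W, ?_, fun μ hμ => ?_⟩).trans ?_
  · rw [hmix]
    refine (mutualInfo_mixture_le _ _ hfst hst').trans ?_
    gcongr
  · rw [hmix]
    exact mixture_absolutelyContinuous hfst hac₀ hac₁ hs' ht' hst'
  · have := hL μ hμ
    rw [meanDistortion_mixKernel hst', ENNReal.ofReal_add (by positivity) (by positivity),
      ENNReal.ofReal_mul hs.le, ENNReal.ofReal_mul ht.le]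
    gcongr
    exacts [hd₀ μ hμ, hd₁ μ hμ]

end ChannelRDf

variable [DecidableEq ι]

/-! ### Quantized reproduction from an estimate of the unsampled components. -/

/-- The vector with components `p.1` on `A` and `p.2` on the complement of `A`. -/
noncomputable def glue (A : Finset ι)
    (p : EuclideanSpace ℝ A × EuclideanSpace ℝ (Aᶜ : Finset ι)) : EuclideanSpace ℝ ι :=
  WithLp.toLp 2 fun i =>
    if h : i ∈ A then p.1 ⟨i, h⟩ else p.2 ⟨i, Finset.mem_compl.2 h⟩

theorem measurable_glue (A : Finset ι) : Measurable (glue A) := by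
  refine (WithLp.measurable_toLp 2 _).comp (measurable_pi_lambda _ fun i => ?_)
  by_cases h : i ∈ A
  · simp only [h, dite_true]
    fun_prop
  · simp only [h, dite_false]
    fun_prop

/-- The sampled components are copied exactly and cancel, which is why only `Aᶜ` enters the minimal
distortion. -/
theorem norm_sub_glue_sq (A : Finset ι) (x : EuclideanSpace ℝ ι)
    (z : EuclideanSpace ℝ (Aᶜ : Finset ι)) :
    ‖x - glue A (sub A x, z)‖ ^ 2 = ‖sub Aᶜ x - z‖ ^ 2 := by
  rw [EuclideanSpace.norm_sq_eq, EuclideanSpace.norm_sq_eq, ← Finset.sum_add_sum_compl A,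
    Finset.sum_eq_zero, zero_add, ← Finset.sum_coe_sort]
  · refine Finset.sum_congr rfl fun i _ => ?_
    have hi : (i : ι) ∉ A := Finset.mem_compl.1 i.2
    simp [glue, sub, hi]
  · intro i hi
    simp [glue, sub, hi]

/-- The channel that reproduces `(X_A, V(X_A))` through the quantizer `Q`. -/
noncomputable def quantizedKernel (A : Finset ι)
    (Q : SimpleFunc (EuclideanSpace ℝ ι) (EuclideanSpace ℝ ι))
    (V : Kernel (EuclideanSpace ℝ A) (EuclideanSpace ℝ (Aᶜ : Finset ι))) :
    Kernel (EuclideanSpace ℝ A) (EuclideanSpace ℝ ι) :=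
  (Kernel.id ×ₖ V).map (fun p => Q (glue A p))

section Quantized

variable {A : Finset ι} {Q : SimpleFunc (EuclideanSpace ℝ ι) (EuclideanSpace ℝ ι)}
  {V : Kernel (EuclideanSpace ℝ A) (EuclideanSpace ℝ (Aᶜ : Finset ι))} [IsMarkovKernel V]

instance isMarkovKernel_quantizedKernel : IsMarkovKernel (quantizedKernel A Q V) :=
  Kernel.IsMarkovKernel.map _ (Q.measurable.comp (measurable_glue A))

theorem quantizedKernel_apply (x : EuclideanSpace ℝ A) :
    quantizedKernel A Q V x = (V x).map (fun z => Q (glue A (x, z))) := by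
  have h : Measurable (fun p => Q (glue A p)) := Q.measurable.comp (measurable_glue A)
  rw [quantizedKernel, Kernel.map_apply _ h, Kernel.prod_apply, Kernel.id_apply,
    Measure.dirac_prod, Measure.map_map h (by fun_prop)]
  rfl

theorem measurable_quantizer_glue (x : EuclideanSpace ℝ A) :
    Measurable (fun z => Q (glue A (x, z))) :=
  Q.measurable.comp ((measurable_glue A).comp measurable_prodMk_left)

theorem ae_mem_range_compProd_quantizedKernel (P : Measure (EuclideanSpace ℝ A)) [SFinite P] :
    ∀ᵐ p ∂(P ⊗ₘ quantizedKernel A Q V), p.2 ∈ Q.range := by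
  refine (Measure.ae_compProd_iff (measurable_snd Q.range.measurableSet)).2
    (Filter.Eventually.of_forall fun x => ?_)
  rw [quantizedKernel_apply]
  exact (ae_map_iff (measurable_quantizer_glue x).aemeasurable Q.range.measurableSet).2
    (Filter.Eventually.of_forall fun z => Q.mem_range_self _)

theorem meanDistortion_quantizedKernel_le {η : ℝ} (hη : 0 < η)
    (hQ : ∀ x y, ‖x - Q y‖ ^ 2 ≤ (1 + η) * ‖x - y‖ ^ 2 + η * (1 + ‖x‖ ^ 4))
    (P : Measure (EuclideanSpace ℝ ι)) [SFinite P] :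
    meanDistortion P A (quantizedKernel A Q V) ≤
      ENNReal.ofReal (1 + η) *
        ∫⁻ x, ∫⁻ z, ENNReal.ofReal (‖sub Aᶜ x - z‖ ^ 2) ∂(V (sub A x)) ∂P +
      ENNReal.ofReal η * quarticMoment P := by
  rw [meanDistortion_eq, quarticMoment, ← lintegral_const_mul' _ _ ENNReal.ofReal_ne_top,
    ← lintegral_const_mul' _ _ ENNReal.ofReal_ne_top, ← lintegral_add_right _ (by fun_prop)]
  refine lintegral_mono fun x => ?_
  rw [quantizedKernel_apply, lintegral_map (by fun_prop) (measurable_quantizer_glue _)]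
  calc _ ≤ ∫⁻ z, (ENNReal.ofReal (1 + η) * ENNReal.ofReal (‖sub Aᶜ x - z‖ ^ 2) +
        ENNReal.ofReal η * ENNReal.ofReal (1 + ‖x‖ ^ 4)) ∂(V (sub A x)) := by
        refine lintegral_mono fun z => ?_
        rw [← ENNReal.ofReal_mul (by positivity), ← ENNReal.ofReal_mul (by positivity),
          ← ENNReal.ofReal_add (by positivity) (by positivity), ← norm_sub_glue_sq]
        exact ENNReal.ofReal_le_ofReal (hQ _ _)
    _ = _ := by
        rw [lintegral_add_right _ measurable_const,
          lintegral_const_mul' _ _ ENNReal.ofReal_ne_top]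
        simp

end Quantized

/-- The two universal settings differ, at a fixed `τ₁`, in the input law and in the set of laws
imposing the distortion constraint: a single mixture here, a whole ambiguity atom in the nonBayesian
case. -/
theorem rhoBayes_eq_channelRDf (A : Finset ι) (κ : Kernel (Matrix A A ℝ) (Matrix ι ι ℝ)) (δ : ℝ)
    (τ₁ : Matrix A A ℝ) :
    rhoBayes A κ δ τ₁ = channelRDf A ((condLaw A κ τ₁).map (sub A)) {condLaw A κ τ₁} δ := by
  simp only [rhoBayes, channelRDf, mem_singleton_iff, forall_eq]

theorem rhoNonBayes_eq_channelRDf (Θ : Set (Matrix ι ι ℝ)) (A : Finset ι) (δ : ℝ)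
    (τ₁ : Matrix A A ℝ) :
    rhoNonBayes Θ A δ τ₁ =
      channelRDf A (multivariateGaussian 0 τ₁) (multivariateGaussian 0 '' atom Θ A τ₁) δ := by
  simp only [rhoNonBayes, channelRDf, forall_mem_image]

section ChannelRDf

variable (A : Finset ι) (P : Measure (EuclideanSpace ℝ A))
  (L : Set (Measure (EuclideanSpace ℝ ι)))

/-- The bound depends on `Q` alone, not on the input law, the constraint set or the estimator; this
uniformity keeps suprema over `τ₁` finite. -/
theorem channelRDf_le_of_quantizer [IsProbabilityMeasure P]
    (Q : SimpleFunc (EuclideanSpace ℝ ι) (EuclideanSpace ℝ ι))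
    (V : Kernel (EuclideanSpace ℝ A) (EuclideanSpace ℝ (Aᶜ : Finset ι))) [IsMarkovKernel V]
    {δ : ℝ} (h : ∀ μ ∈ L, meanDistortion μ A (quantizedKernel A Q V) ≤ ENNReal.ofReal δ) :
    channelRDf A P L δ ≤ (1 + Q.range.card) / ENNReal.ofReal (Real.log 2) :=
  have hF := ae_mem_range_compProd_quantizedKernel (Q := Q) (V := V) P
  (iInf₂_le (quantizedKernel A Q V)
    ⟨inferInstance, absolutelyContinuous_of_finite_range hF, h⟩).trans
    (mutualInfo_le_of_finite_range hF)

end ChannelRDf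

end

/-! ### Uniform moments over a compact set, and the nonBayesian setting. -/

section

variable {ι : Type*} [Fintype ι]

theorem norm_sub_block_sq_le (A : Finset ι) (x : EuclideanSpace ℝ ι) :
    ‖sub A x‖ ^ 2 ≤ ‖x‖ ^ 2 := by
  rw [EuclideanSpace.norm_sq_eq, EuclideanSpace.norm_sq_eq]
  simp only [sub]
  rw [Finset.sum_coe_sort A (fun i => ‖x i‖ ^ 2)]
  exact Finset.sum_le_univ_sum_of_nonneg fun i => by positivity

theorem lintegral_norm_sub_sq_le_quarticMoment (A : Finset ι)
    (P : Measure (EuclideanSpace ℝ ι)) :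
    ∫⁻ x, ENNReal.ofReal (‖sub A x‖ ^ 2) ∂P ≤ quarticMoment P := by
  refine lintegral_mono fun x => ENNReal.ofReal_le_ofReal ((norm_sub_block_sq_le A x).trans ?_)
  nlinarith [sq_nonneg (‖x‖ ^ 2 - 1)]

variable [DecidableEq ι]

theorem norm_toEuclideanCLM_sqrt_sq {τ : Matrix ι ι ℝ} (hτ : τ.PosSemidef)
    (x : EuclideanSpace ℝ ι) :
    ‖toEuclideanCLM (𝕜 := ℝ) (CFC.sqrt τ) x‖ ^ 2 = x.ofLp ⬝ᵥ τ *ᵥ x.ofLp := by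
  have hs : (CFC.sqrt τ)ᵀ = CFC.sqrt τ := by
    have h := (Matrix.nonneg_iff_posSemidef.1 (CFC.sqrt_nonneg τ)).1
    rwa [Matrix.IsHermitian, conjTranspose_eq_transpose_of_trivial] at h
  have h1 : ‖toEuclideanCLM (𝕜 := ℝ) (CFC.sqrt τ) x‖ ^ 2 =
      (CFC.sqrt τ *ᵥ x.ofLp) ⬝ᵥ (CFC.sqrt τ *ᵥ x.ofLp) := by
    rw [EuclideanSpace.norm_sq_eq]
    simp [dotProduct, sq]
  rw [h1, dotProduct_mulVec, vecMul_mulVec, ← dotProduct_mulVec, hs,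
    CFC.sqrt_mul_sqrt_self τ hτ.nonneg]

/-- The fourth moment of `N(0, τ)` is bounded for `τ` in a compact set. -/
theorem exists_quarticMoment_multivariateGaussian_le {Θ : Set (Matrix ι ι ℝ)} (hΘ : IsCompact Θ)
    (hpos : ∀ τ ∈ Θ, τ.PosDef) :
    ∃ C : ℝ, 0 ≤ C ∧ ∀ τ ∈ Θ,
      quarticMoment (multivariateGaussian (0 : EuclideanSpace ℝ ι) τ) ≤ ENNReal.ofReal C := by
  have hcont : ContinuousOn (fun τ : Matrix ι ι ℝ => ∑ i, ∑ j, |τ i j|) Θ := by fun_prop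
  obtain ⟨K, hK⟩ := hΘ.bddAbove_image hcont
  set c := (quarticMoment (stdGaussian (EuclideanSpace ℝ ι))).toReal
  -- `N(0, τ)` is the image of the standard Gaussian under `√τ`, and `‖√τ x‖ ^ 2 = xᵀ τ x ≤ K * ‖x‖
  -- ^ 2`, so the fourth power costs `K ^ 2`.
  refine ⟨(1 + K ^ 2) * c, by positivity, fun τ hτ => ?_⟩
  have hKτ : ∑ i, ∑ j, |τ i j| ≤ K := hK (mem_image_of_mem _ hτ)
  have hK0 : 0 ≤ K := le_trans (by positivity) hKτ
  rw [quarticMoment, multivariateGaussian, lintegral_map (by fun_prop) (by fun_prop),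
    ENNReal.ofReal_mul (by positivity),
    ENNReal.ofReal_toReal (quarticMoment_ne_top_of_isGaussian _), quarticMoment,
    ← lintegral_const_mul' _ _ ENNReal.ofReal_ne_top]
  refine lintegral_mono fun x => ?_
  rw [← ENNReal.ofReal_mul (by positivity), zero_add]
  apply ENNReal.ofReal_le_ofReal
  have h1 : ‖toEuclideanCLM (𝕜 := ℝ) (CFC.sqrt τ) x‖ ^ 2 ≤ K * ‖x‖ ^ 2 := by
    rw [norm_toEuclideanCLM_sqrt_sq (hpos τ hτ).posSemidef]
    refine (dotProduct_mulVec_le τ x).trans ?_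
    gcongr
  have h2 : ‖toEuclideanCLM (𝕜 := ℝ) (CFC.sqrt τ) x‖ ^ 4 ≤ K ^ 2 * ‖x‖ ^ 4 := by
    have := pow_le_pow_left₀ (by positivity) h1 2
    calc _ = (‖toEuclideanCLM (𝕜 := ℝ) (CFC.sqrt τ) x‖ ^ 2) ^ 2 := by ring
      _ ≤ _ := this
      _ = _ := by ring
  have h3 : 0 ≤ ‖x‖ ^ 4 := by positivity
  have h4 : 0 ≤ K ^ 2 := by positivity
  nlinarith

theorem meanDistortion_quantizedKernel_le_ofReal {A : Finset ι}
    {Q : SimpleFunc (EuclideanSpace ℝ ι) (EuclideanSpace ℝ ι)}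
    {V : Kernel (EuclideanSpace ℝ A) (EuclideanSpace ℝ (Aᶜ : Finset ι))} [IsMarkovKernel V]
    {η : ℝ} (hη : 0 < η)
    (hQ : ∀ x y, ‖x - Q y‖ ^ 2 ≤ (1 + η) * ‖x - y‖ ^ 2 + η * (1 + ‖x‖ ^ 4))
    {P : Measure (EuclideanSpace ℝ ι)} [SFinite P] {u C : ℝ} (hu0 : 0 ≤ u) (hC0 : 0 ≤ C)
    (hu : ∫⁻ x, ∫⁻ z, ENNReal.ofReal (‖sub Aᶜ x - z‖ ^ 2) ∂(V (sub A x)) ∂P ≤ ENNReal.ofReal u)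
    (hC : quarticMoment P ≤ ENNReal.ofReal C) :
    meanDistortion P A (quantizedKernel A Q V) ≤ ENNReal.ofReal ((1 + η) * u + η * C) := by
  refine (meanDistortion_quantizedKernel_le hη hQ P).trans ?_
  have h1 : 0 ≤ (1 + η) * u := by positivity
  rw [ENNReal.ofReal_add h1 (by positivity), ENNReal.ofReal_mul (p := 1 + η) (by positivity),
    ENNReal.ofReal_mul hη.le]
  gcongr

section NonBayes

variable {Θ : Set (Matrix ι ι ℝ)} {A : Finset ι}

theorem dminNonBayesAt_le {C : ℝ≥0∞}
    (hC : ∀ τ ∈ Θ, quarticMoment (multivariateGaussian (0 : EuclideanSpace ℝ ι) τ) ≤ C)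
    (τ₁ : Matrix A A ℝ) : dminNonBayesAt Θ A τ₁ ≤ C := by
  refine (iInf₂_le (Kernel.const _ (Measure.dirac 0))
    (show IsMarkovKernel _ from inferInstance)).trans (iSup₂_le fun τ hτ => ?_)
  refine le_trans (le_of_eq ?_)
    ((lintegral_norm_sub_sq_le_quarticMoment Aᶜ (multivariateGaussian 0 τ)).trans (hC τ hτ.1))
  simp

theorem usrdfNonBayes_ne_top (hΘ : IsCompact Θ) (hpos : ∀ τ ∈ Θ, τ.PosDef) {D : ℝ}
    (hD : dminNonBayes Θ A < D) : usrdfNonBayes Θ A D ≠ ∞ := by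
  obtain ⟨C, hC0, hC⟩ := exists_quarticMoment_multivariateGaussian_le hΘ hpos
  set d := dminNonBayes Θ A with hd
  have hd0 : 0 ≤ d := ENNReal.toReal_nonneg
  -- Estimating by zero shows that the supremum is finite, so the `toReal` in `dminNonBayes` is a
  -- true value.
  have hfin : (⨆ τ₁ ∈ marginalSet Θ A, dminNonBayesAt Θ A τ₁) ≠ ∞ :=
    ne_top_of_le_ne_top ENNReal.ofReal_ne_top (iSup₂_le fun τ₁ _ => dminNonBayesAt_le hC τ₁)
  -- `d + η` allows for a nearly optimal estimator; the factor `1 + η` and the term `η * C` are the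
  -- quantization loss.
  obtain ⟨η, hη, hηD⟩ : ∃ η > 0, (1 + η) * (d + η) + η * C < D := by
    have h : Filter.Tendsto (fun η : ℝ => (1 + η) * (d + η) + η * C) (nhdsWithin 0 (Ioi 0))
        (nhds ((1 + 0) * (d + 0) + 0 * C)) :=
      (Continuous.tendsto (by fun_prop) 0).mono_left nhdsWithin_le_nhds
    obtain ⟨η, h1, h2⟩ := ((h.eventually_lt_const (by simpa using hD)).and
      self_mem_nhdsWithin).exists
    exact ⟨η, h2, h1⟩
  obtain ⟨Q, hQ⟩ := exists_quantizer (E := EuclideanSpace ℝ ι) hη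
  refine ne_top_of_le_ne_top (finiteRange_bound_ne_top Q.range) (iSup₂_le fun τ₁ hτ₁ => ?_)
  have hlt : dminNonBayesAt Θ A τ₁ < ENNReal.ofReal (d + η) := by
    refine (le_iSup₂ (f := fun τ₁ (_ : τ₁ ∈ marginalSet Θ A) => dminNonBayesAt Θ A τ₁)
      τ₁ hτ₁).trans_lt ?_
    rw [← ENNReal.ofReal_toReal hfin]
    exact (ENNReal.ofReal_lt_ofReal_iff (by positivity)).2 (lt_add_of_pos_right _ hη)
  obtain ⟨V, hV, hVlt⟩ := exists_mem_lt_of_biInf_lt hlt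
  have : IsMarkovKernel V := hV
  rw [rhoNonBayes_eq_channelRDf]
  refine channelRDf_le_of_quantizer A _ _ Q V ?_
  rintro _ ⟨τ, hτ, rfl⟩
  refine le_trans ?_ (ENNReal.ofReal_le_ofReal hηD.le)
  refine meanDistortion_quantizedKernel_le_ofReal hη hQ (by positivity) hC0 ?_ (hC τ hτ.1)
  exact (le_iSup₂ (f := fun τ (_ : τ ∈ atom Θ A τ₁) => ∫⁻ x, ∫⁻ y,
    ENNReal.ofReal (‖sub Aᶜ x - y‖ ^ 2) ∂(V (sub A x)) ∂(multivariateGaussian 0 τ))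
    τ hτ).trans hVlt.le

theorem isRateDistortionShaped_usrdfNonBayes (hΘ : IsCompact Θ) (hpos : ∀ τ ∈ Θ, τ.PosDef)
    (b : ℝ) : IsRateDistortionShaped (usrdfNonBayes Θ A) (dminNonBayes Θ A) b := by
  refine IsRateDistortionShaped.of_Ioi b (fun D hD => usrdfNonBayes_ne_top hΘ hpos hD)
    (fun x y hxy => iSup₂_mono fun τ₁ _ => ?_) fun x y hx hy s t hs ht hst =>
      iSup₂_le fun τ₁ hτ₁ => ?_
  · simp only [rhoNonBayes_eq_channelRDf]
    exact channelRDf_antitone _ _ _ hxy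
  -- Nonnegative thresholds are needed because `ENNReal.ofReal` truncates negative ones and is then
  -- not additive.
  · have hd0 : 0 ≤ dminNonBayes Θ A := ENNReal.toReal_nonneg
    have hle : ∀ D, rhoNonBayes Θ A D τ₁ ≤ usrdfNonBayes Θ A D := fun D =>
      le_iSup₂ (f := fun τ₁ (_ : τ₁ ∈ marginalSet Θ A) => rhoNonBayes Θ A D τ₁) τ₁ hτ₁
    calc _ ≤ ENNReal.ofReal s * rhoNonBayes Θ A x τ₁ +
          ENNReal.ofReal t * rhoNonBayes Θ A y τ₁ := by
          simp only [rhoNonBayes_eq_channelRDf]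
          refine channelRDf_convex _ _ _ ?_ (hd0.trans hx.le) (hd0.trans hy.le) hs ht hst
          rintro _ ⟨τ, _, rfl⟩
          infer_instance
      _ ≤ _ := by gcongr <;> apply hle

end NonBayes

end

/-! ### Mean-square estimation. -/

theorem memLp_two_of_lintegral_ne_top {α E : Type*} [MeasurableSpace α] [NormedAddCommGroup E]
    {μ : Measure α} {f : α → E} (hf : AEStronglyMeasurable f μ)
    (h : ∫⁻ x, ENNReal.ofReal (‖f x‖ ^ 2) ∂μ ≠ ∞) : MemLp f 2 μ := by
  rw [memLp_two_iff_integrable_sq_norm hf]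
  refine ⟨hf.norm.pow 2, ?_⟩
  rw [hasFiniteIntegral_iff_ofReal (Filter.Eventually.of_forall fun x => by positivity)]
  exact h.lt_top

/-- The mean minimises the mean squared distance. -/
theorem lintegral_norm_sub_integral_sq_le {F : Type*} [NormedAddCommGroup F]
    [InnerProductSpace ℝ F] [CompleteSpace F] [MeasurableSpace F] [BorelSpace F]
    [SecondCountableTopology F] (ρ : Measure F) [IsProbabilityMeasure ρ] (y : F) :
    ∫⁻ z, ENNReal.ofReal (‖z - ∫ w, w ∂ρ‖ ^ 2) ∂ρ ≤ ∫⁻ z, ENNReal.ofReal (‖z - y‖ ^ 2) ∂ρ := by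
  -- An infinite right side is trivial and covers the laws whose mean is only the default value `0`;
  -- otherwise the identity is square integrable and the cross term about the mean vanishes.
  by_cases h : ∫⁻ z, ENNReal.ofReal (‖z - y‖ ^ 2) ∂ρ = ∞
  · rw [h]; exact le_top
  have hy : MemLp (fun z => z - y) 2 ρ := memLp_two_of_lintegral_ne_top (by fun_prop) h
  have hid : MemLp (fun z : F => z) 2 ρ := by
    refine (hy.add (memLp_const y)).congr_norm (by fun_prop) ?_
    exact Filter.Eventually.of_forall fun z => by simp
  have hint : Integrable (fun z : F => z) ρ := hid.integrable (by norm_num)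
  set m := ∫ w, w ∂ρ
  have hm : MemLp (fun z => z - m) 2 ρ := hid.sub (memLp_const m)
  have hmi := hm.integrable_norm_pow (p := 2) (by norm_num)
  have hyi := hy.integrable_norm_pow (p := 2) (by norm_num)
  rw [← ofReal_integral_eq_lintegral_ofReal hmi (Filter.Eventually.of_forall fun _ => by positivity),
    ← ofReal_integral_eq_lintegral_ofReal hyi (Filter.Eventually.of_forall fun _ => by positivity)]
  apply ENNReal.ofReal_le_ofReal
  have hsub : Integrable (fun z => z - m) ρ := hint.sub (integrable_const m)
  have hinner : Integrable (fun z => inner ℝ (m - y) (z - m)) ρ := hsub.const_inner (m - y)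
  have hzero : ∫ z, inner ℝ (m - y) (z - m) ∂ρ = 0 := by
    rw [integral_inner hsub, integral_sub hint (integrable_const m)]
    simp [m]
  calc ∫ z, ‖z - m‖ ^ 2 ∂ρ = ∫ z, (‖z - m‖ ^ 2 + 2 * inner ℝ (m - y) (z - m)) ∂ρ := by
        rw [integral_add hmi (hinner.const_mul 2), integral_const_mul, hzero]
        simp
    _ ≤ ∫ z, ‖z - y‖ ^ 2 ∂ρ := by
        refine integral_mono (hmi.add (hinner.const_mul 2)) hyi fun z => ?_
        have h1 : z - y = (z - m) + (m - y) := by abel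
        have h2 := norm_add_sq_real (z - m) (m - y)
        rw [← h1, real_inner_comm] at h2
        simp only
        nlinarith [sq_nonneg ‖m - y‖]

/-- There is a countable family of measurable functions that is dense in `L²(P)` for every
probability measure `P`. -/
theorem exists_countable_dense_estimators (E F : Type*) [NormedAddCommGroup E] [NormedSpace ℝ E]
    [FiniteDimensional ℝ E] [MeasurableSpace E] [BorelSpace E] [NormedAddCommGroup F]
    [NormedSpace ℝ F] [FiniteDimensional ℝ F] [MeasurableSpace F] [BorelSpace F] :
    ∃ h : ℕ × ℕ → E → F, (∀ k, Measurable (h k)) ∧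
      ∀ (P : Measure E) [IsProbabilityMeasure P] (m : E → F), MemLp m 2 P →
        ∀ ε : ℝ, 0 < ε → ∃ k, ∫⁻ x, ENNReal.ofReal (‖m x - h k x‖ ^ 2) ∂P ≤ ENNReal.ofReal ε := by
  have : ProperSpace E := FiniteDimensional.proper_real E
  have : ProperSpace F := FiniteDimensional.proper_real F
  -- A dense sequence of `C(E, F)` in the compact-open topology, cut off to balls of integer radius.
  -- A compactly supported continuous approximant of `m` is matched uniformly on a ball containing
  -- its support, and the cutoff removes the error outside.
  refine ⟨fun k => (Metric.closedBall (0 : E) k.1).indicator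
    (TopologicalSpace.denseSeq C(E, F) k.2), fun k =>
    (ContinuousMap.continuous _).measurable.indicator Metric.isClosed_closedBall.measurableSet,
    fun P _ m hm ε hε => ?_⟩
  obtain ⟨ξ, hξ, hξε⟩ : ∃ ξ : ℝ, 0 < ξ ∧ 4 * ξ ^ 2 ≤ ε := by
    refine ⟨Real.sqrt (ε / 4), by positivity, ?_⟩
    rw [Real.sq_sqrt (by positivity)]
    exact le_of_eq (by ring)
  obtain ⟨g, hgc, hg, hgcont, hgL⟩ := hm.exists_hasCompactSupport_eLpNorm_sub_le (by norm_num)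
    (ε := ENNReal.ofReal ξ) (by simpa using hξ)
  obtain ⟨r, hr⟩ := hgc.isCompact.isBounded.subset_closedBall (0 : E)
  obtain ⟨N, hN⟩ := exists_nat_ge r
  have hgN : ∀ x ∉ Metric.closedBall (0 : E) N, g x = 0 := fun x hx => by
    by_contra h
    exact hx (Metric.closedBall_subset_closedBall hN (hr (subset_tsupport g h)))
  have hnhds : ∀ᶠ f in nhds (⟨g, hgcont⟩ : C(E, F)),
      ∀ x ∈ Metric.closedBall (0 : E) N, dist (g x) (f x) < ξ :=
    Metric.tendstoUniformlyOn_iff.1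
      (ContinuousMap.tendsto_iff_forall_isCompact_tendstoUniformlyOn.1
        (Filter.tendsto_id (α := C(E, F)) (x := nhds (⟨g, hgcont⟩ : C(E, F)))) _
        (isCompact_closedBall (0 : E) N)) ξ hξ
  obtain ⟨n, hn⟩ := (TopologicalSpace.denseRange_denseSeq C(E, F)).mem_nhds hnhds
  refine ⟨(N, n), ?_⟩
  set q : E → F := (Metric.closedBall (0 : E) N).indicator (TopologicalSpace.denseSeq C(E, F) n)
  have hgq : ∀ x, ‖g x - q x‖ ≤ ξ := fun x => by
    by_cases hx : x ∈ Metric.closedBall (0 : E) N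
    · simp only [q, indicator_of_mem hx, ← dist_eq_norm]
      exact (hn x hx).le
    · simp [q, indicator_of_notMem hx, hgN x hx, hξ.le]
  have hmg : ∫⁻ x, ENNReal.ofReal (‖m x - g x‖ ^ 2) ∂P ≤ ENNReal.ofReal (ξ ^ 2) := by
    have h1 := eLpNorm_nnreal_pow_eq_lintegral (f := m - g) (μ := P) (p := 2) (by norm_num)
    have h2 : ∫⁻ x, ENNReal.ofReal (‖m x - g x‖ ^ 2) ∂P =
        eLpNorm (m - g) 2 P ^ 2 := by
      simp only [NNReal.coe_ofNat, ENNReal.coe_ofNat, ENNReal.rpow_ofNat] at h1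
      rw [h1]
      refine lintegral_congr fun x => ?_
      rw [ENNReal.ofReal_pow (norm_nonneg _), ofReal_norm]
      rfl
    rw [h2, ENNReal.ofReal_pow hξ.le]
    gcongr
  calc _ ≤ ∫⁻ x, (2 * ENNReal.ofReal (‖m x - g x‖ ^ 2) + ENNReal.ofReal (2 * ξ ^ 2)) ∂P := by
        refine lintegral_mono fun x => ?_
        rw [← ENNReal.ofReal_ofNat 2, ← ENNReal.ofReal_mul (by norm_num),
          ← ENNReal.ofReal_add (by positivity) (by positivity)]
        apply ENNReal.ofReal_le_ofReal
        have h1 : ‖m x - q x‖ ≤ ‖m x - g x‖ + ξ := by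
          have := norm_add_le (m x - g x) (g x - q x)
          rw [sub_add_sub_cancel] at this
          linarith [hgq x]
        have h2 : ‖m x - q x‖ ^ 2 ≤ (‖m x - g x‖ + ξ) ^ 2 := by gcongr
        nlinarith [sq_nonneg (‖m x - g x‖ - ξ)]
    _ = 2 * ∫⁻ x, ENNReal.ofReal (‖m x - g x‖ ^ 2) ∂P + ENNReal.ofReal (2 * ξ ^ 2) := by
        rw [lintegral_add_right _ measurable_const,
          lintegral_const_mul' _ _ ENNReal.ofNat_ne_top]
        simp
    _ ≤ 2 * ENNReal.ofReal (ξ ^ 2) + ENNReal.ofReal (2 * ξ ^ 2) := by gcongr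
    _ ≤ ENNReal.ofReal ε := by
        rw [← ENNReal.ofReal_ofNat 2, ← ENNReal.ofReal_mul (by norm_num),
          ← ENNReal.ofReal_add (by positivity) (by positivity)]
        exact ENNReal.ofReal_le_ofReal (by linarith)


/-! ### The Bayesian setting. -/

section

theorem continuous_block {ι : Type*} (A : Finset ι) :
    Continuous (fun τ : Matrix ι ι ℝ => block τ A A) := by
  unfold block
  fun_prop

variable {ι : Type*} [Fintype ι]

theorem ae_mem_marginalSet {Θ : Set (Matrix ι ι ℝ)} {ν : Measure (Matrix ι ι ℝ)} {A : Finset ι}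
    (hΘ : IsCompact Θ) (hν : ν Θᶜ = 0) :
    ∀ᵐ τ₁ ∂(marginalPrior ν A), τ₁ ∈ marginalSet Θ A := by
  have hc : IsCompact (marginalSet Θ A) := hΘ.image (continuous_block A)
  refine (ae_map_iff (continuous_block A).measurable.aemeasurable hc.measurableSet).2 ?_
  filter_upwards [compl_mem_ae_iff.2 hν] with τ hτ
  exact mem_image_of_mem _ (by simpa using hτ)

theorem isProbabilityMeasure_marginalPrior {ν : Measure (Matrix ι ι ℝ)}
    [IsProbabilityMeasure ν] {A : Finset ι} : IsProbabilityMeasure (marginalPrior ν A) :=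
  Measure.isProbabilityMeasure_map (continuous_block A).measurable.aemeasurable

variable [DecidableEq ι]

/-- The mean squared error of the estimate `h(X_A)` of the unsampled components. -/
noncomputable def estimationError (A : Finset ι)
    (h : EuclideanSpace ℝ A → EuclideanSpace ℝ (Aᶜ : Finset ι))
    (P : Measure (EuclideanSpace ℝ ι)) : ℝ≥0∞ :=
  ∫⁻ x, ENNReal.ofReal (‖sub Aᶜ x - h (sub A x)‖ ^ 2) ∂P

theorem lintegral_condDistrib_sub (A : Finset ι) (P : Measure (EuclideanSpace ℝ ι))
    [IsProbabilityMeasure P]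
    {f : EuclideanSpace ℝ A × EuclideanSpace ℝ (Aᶜ : Finset ι) → ℝ≥0∞} (hf : Measurable f) :
    ∫⁻ xA, ∫⁻ z, f (xA, z) ∂(condDistrib (sub Aᶜ) (sub A) P xA) ∂(P.map (sub A)) =
      ∫⁻ x, f (sub A x, sub Aᶜ x) ∂P := by
  have := Measure.isProbabilityMeasure_map (μ := P) (measurable_sub A).aemeasurable
  rw [← Measure.lintegral_compProd hf,
    compProd_map_condDistrib (measurable_sub Aᶜ).aemeasurable,
    lintegral_map hf ((measurable_sub A).prodMk (measurable_sub Aᶜ))]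

/-- The conditional mean attains the minimal mean squared error. -/
theorem exists_estimationError_le (A : Finset ι) (P : Measure (EuclideanSpace ℝ ι))
    [IsProbabilityMeasure P] :
    ∃ m : EuclideanSpace ℝ A → EuclideanSpace ℝ (Aᶜ : Finset ι), Measurable m ∧
      estimationError A m P ≤ ∫⁻ xA, ⨅ y : EuclideanSpace ℝ (Aᶜ : Finset ι),
        ∫⁻ z, ENNReal.ofReal (‖z - y‖ ^ 2) ∂(condDistrib (sub Aᶜ) (sub A) P xA)
        ∂(P.map (sub A)) := by
  set K := condDistrib (sub Aᶜ) (sub A) P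
  have hm : Measurable (fun xA => ∫ z, z ∂(K xA)) :=
    (StronglyMeasurable.integral_kernel (κ := K) (f := fun z => z)
      measurable_id.stronglyMeasurable).measurable
  refine ⟨_, hm, ?_⟩
  have h := lintegral_condDistrib_sub A P
    (f := fun p => ENNReal.ofReal (‖p.2 - ∫ z, z ∂(K p.1)‖ ^ 2))
    (((measurable_snd.sub (hm.comp measurable_fst)).norm.pow_const 2).ennreal_ofReal)
  rw [estimationError, ← h]
  exact lintegral_mono fun xA => le_iInf fun y => lintegral_norm_sub_integral_sq_le (K xA) y

theorem lintegral_iInf_le_quarticMoment (A : Finset ι) (P : Measure (EuclideanSpace ℝ ι))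
    [IsProbabilityMeasure P] :
    ∫⁻ xA, ⨅ y : EuclideanSpace ℝ (Aᶜ : Finset ι),
        ∫⁻ z, ENNReal.ofReal (‖z - y‖ ^ 2) ∂(condDistrib (sub Aᶜ) (sub A) P xA)
        ∂(P.map (sub A)) ≤ quarticMoment P := by
  refine (lintegral_mono fun xA => iInf_le _ 0).trans ?_
  simp only [sub_zero]
  calc _ = ∫⁻ x, ENNReal.ofReal (‖sub Aᶜ x‖ ^ 2) ∂P :=
        lintegral_condDistrib_sub A P (f := fun p => ENNReal.ofReal (‖p.2‖ ^ 2)) (by fun_prop)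
    _ ≤ _ := lintegral_norm_sub_sq_le_quarticMoment _ _

/-- `m(X_A)` is the difference of `X_{Aᶜ}` and the estimation error, both square integrable, so `m`
lies in `L²` of the law of `X_A` and the dense family approximates it. -/
theorem exists_estimationError_le_of_dense {A : Finset ι}
    {h : ℕ × ℕ → EuclideanSpace ℝ A → EuclideanSpace ℝ (Aᶜ : Finset ι)}
    (hh : ∀ (P : Measure (EuclideanSpace ℝ A)) [IsProbabilityMeasure P]
      (m : EuclideanSpace ℝ A → EuclideanSpace ℝ (Aᶜ : Finset ι)), MemLp m 2 P →
        ∀ ε : ℝ, 0 < ε → ∃ k, ∫⁻ x, ENNReal.ofReal (‖m x - h k x‖ ^ 2) ∂P ≤ ENNReal.ofReal ε)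
    (hhm : ∀ k, Measurable (h k))
    (P : Measure (EuclideanSpace ℝ ι)) [IsProbabilityMeasure P] (hP : quarticMoment P ≠ ∞)
    {m : EuclideanSpace ℝ A → EuclideanSpace ℝ (Aᶜ : Finset ι)} (hm : Measurable m)
    (hmP : estimationError A m P ≠ ∞) {η : ℝ} (hη : 0 < η) :
    ∃ k, estimationError A (h k) P ≤
      ENNReal.ofReal (1 + η) * estimationError A m P + ENNReal.ofReal η := by
  have := Measure.isProbabilityMeasure_map (μ := P) (measurable_sub A).aemeasurable
  have hsub : MemLp (sub (Aᶜ : Finset ι)) 2 P :=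
    memLp_two_of_lintegral_ne_top (measurable_sub _).aestronglyMeasurable
      (ne_top_of_le_ne_top hP (lintegral_norm_sub_sq_le_quarticMoment _ _))
  have herr : MemLp (fun x => sub Aᶜ x - m (sub A x)) 2 P :=
    memLp_two_of_lintegral_ne_top
      ((measurable_sub _).sub (hm.comp (measurable_sub _))).aestronglyMeasurable hmP
  have hmA : MemLp m 2 (P.map (sub A)) := by
    rw [memLp_map_measure_iff hm.aestronglyMeasurable (measurable_sub A).aemeasurable]
    refine (hsub.sub herr).congr_norm (hm.comp (measurable_sub A)).aestronglyMeasurable ?_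
    exact Filter.Eventually.of_forall fun x => by simp
  -- The denominator cancels the factor `1 + η⁻¹` that Young's inequality puts on the approximation
  -- error.
  obtain ⟨k, hk⟩ := hh _ m hmA (η / (1 + η⁻¹)) (by positivity)
  refine ⟨k, ?_⟩
  rw [lintegral_map (by have := hhm k; fun_prop) (measurable_sub A)] at hk
  calc estimationError A (h k) P ≤ ∫⁻ x, (ENNReal.ofReal (1 + η) *
          ENNReal.ofReal (‖sub Aᶜ x - m (sub A x)‖ ^ 2) + ENNReal.ofReal (1 + η⁻¹) *
          ENNReal.ofReal (‖m (sub A x) - h k (sub A x)‖ ^ 2)) ∂P := by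
        refine lintegral_mono fun x => ?_
        rw [← ENNReal.ofReal_mul (by positivity), ← ENNReal.ofReal_mul (by positivity),
          ← ENNReal.ofReal_add (by positivity) (by positivity)]
        apply ENNReal.ofReal_le_ofReal
        have h1 := norm_add_le (sub Aᶜ x - m (sub A x)) (m (sub A x) - h k (sub A x))
        rw [sub_add_sub_cancel] at h1
        generalize ‖sub Aᶜ x - m (sub A x)‖ = a at *
        generalize ‖m (sub A x) - h k (sub A x)‖ = b at *
        have h2 := pow_le_pow_left₀ (norm_nonneg _) h1 2
        have h4 : 0 ≤ η⁻¹ * (η * a - b) ^ 2 := by positivity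
        have h5 : η⁻¹ * (η * a - b) ^ 2 = η * a ^ 2 - 2 * a * b + η⁻¹ * b ^ 2 := by
          field_simp; ring
        nlinarith
    _ = ENNReal.ofReal (1 + η) * estimationError A m P + ENNReal.ofReal (1 + η⁻¹) *
          ∫⁻ x, ENNReal.ofReal (‖m (sub A x) - h k (sub A x)‖ ^ 2) ∂P := by
        have h1 : Measurable fun x => ENNReal.ofReal (‖sub Aᶜ x - m (sub A x)‖ ^ 2) :=
          (((measurable_sub _).sub (hm.comp (measurable_sub _))).norm.pow_const 2).ennreal_ofReal
        rw [lintegral_add_left (h1.const_mul _), lintegral_const_mul' _ _ ENNReal.ofReal_ne_top,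
          lintegral_const_mul' _ _ ENNReal.ofReal_ne_top, estimationError]
    _ ≤ ENNReal.ofReal (1 + η) * estimationError A m P + ENNReal.ofReal (1 + η⁻¹) *
          ENNReal.ofReal (η / (1 + η⁻¹)) := by gcongr
    _ = _ := by
        rw [← ENNReal.ofReal_mul (by positivity), mul_div_cancel₀ _ (by positivity)]

section Bayes

variable {Θ : Set (Matrix ι ι ℝ)} {ν : Measure (Matrix ι ι ℝ)} {A : Finset ι}
  {κ : Kernel (Matrix A A ℝ) (Matrix ι ι ℝ)}

theorem usrdfBayes_antitone : Antitone (usrdfBayes Θ ν A κ) := by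
  intro x y hxy
  exact le_iInf₂ fun δ hδ => iInf₂_le δ ⟨hδ.1, hδ.2.1, hδ.2.2.1, hδ.2.2.2.trans hxy⟩

theorem usrdfBayes_le {δ : Matrix A A ℝ → ℝ} (hm : Measurable δ) (hn : ∀ τ₁, 0 ≤ δ τ₁)
    (hi : Integrable δ (marginalPrior ν A)) {D : ℝ} (hD : ∫ τ₁, δ τ₁ ∂(marginalPrior ν A) ≤ D)
    {c : ℝ≥0∞} (hc : ∀ τ₁ ∈ marginalSet Θ A, rhoBayes A κ (δ τ₁) τ₁ ≤ c) :
    usrdfBayes Θ ν A κ D ≤ c :=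
  (iInf₂_le δ ⟨hm, hn, hi, hD⟩).trans (iSup₂_le hc)

theorem quarticMoment_condLaw_le [IsMarkovKernel κ] {C : ℝ≥0∞}
    (hC : ∀ τ ∈ Θ, quarticMoment (multivariateGaussian (0 : EuclideanSpace ℝ ι) τ) ≤ C)
    (hκ : ∀ τ₁ ∈ marginalSet Θ A, κ τ₁ (atom Θ A τ₁)ᶜ = 0) {τ₁ : Matrix A A ℝ}
    (hτ₁ : τ₁ ∈ marginalSet Θ A) : quarticMoment (condLaw A κ τ₁) ≤ C := by
  rw [quarticMoment, condLaw, Kernel.lintegral_comp _ _ _ (by fun_prop)]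
  calc _ ≤ ∫⁻ _, C ∂(κ τ₁) := by
        refine lintegral_mono_ae ?_
        filter_upwards [compl_mem_ae_iff.2 (hκ τ₁ hτ₁)] with τ hτ
        rw [compl_compl] at hτ
        exact hC τ hτ.1
    _ = C := by simp

variable [IsMarkovKernel κ]

/-- The allowances must be measurable in `τ₁`, yet conditional-mean estimators are chosen separately
for each `τ₁`. The best error within one countable family is measurable and nearly optimal at every
`τ₁ ∈ Θ₁`. -/
theorem usrdfBayes_ne_top [IsProbabilityMeasure ν] (hΘ : IsCompact Θ) (hpos : ∀ τ ∈ Θ, τ.PosDef) (hν : ν Θᶜ = 0)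
    (hκ : ∀ τ₁ ∈ marginalSet Θ A, κ τ₁ (atom Θ A τ₁)ᶜ = 0) {D : ℝ}
    (hD : dminBayes ν A κ < D) : usrdfBayes Θ ν A κ D ≠ ∞ := by
  have := isProbabilityMeasure_marginalPrior (ν := ν) (A := A)
  obtain ⟨C, hC0, hC⟩ := exists_quarticMoment_multivariateGaussian_le hΘ hpos
  have hmom : ∀ τ₁ ∈ marginalSet Θ A, quarticMoment (condLaw A κ τ₁) ≤ ENNReal.ofReal C :=
    fun τ₁ hτ₁ => quarticMoment_condLaw_le hC hκ hτ₁
  have hae := ae_mem_marginalSet (A := A) hΘ hν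
  have hat : ∀ τ₁ ∈ marginalSet Θ A, dminBayesAt A κ τ₁ ≤ ENNReal.ofReal C := fun τ₁ hτ₁ =>
    (lintegral_iInf_le_quarticMoment A (condLaw A κ τ₁)).trans (hmom τ₁ hτ₁)
  have hfin : ∫⁻ τ₁, dminBayesAt A κ τ₁ ∂(marginalPrior ν A) ≠ ∞ := by
    refine ne_top_of_le_ne_top ENNReal.ofReal_ne_top (b := ENNReal.ofReal C) ?_
    refine (lintegral_mono_ae (g := fun _ => ENNReal.ofReal C) ?_).trans (by simp)
    filter_upwards [hae] with τ₁ hτ₁ using hat τ₁ hτ₁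
  set d := dminBayes ν A κ with hd
  have hd0 : 0 ≤ d := ENNReal.toReal_nonneg
  -- The inner `(1 + η) * d + η` bounds the mean of the best error in the family, the next `η` pays
  -- for selecting a member, and the outer factor with `η * C` for quantizing.
  obtain ⟨η, hη, hηD⟩ : ∃ η > 0, (1 + η) * ((1 + η) * d + η + η) + η * C < D := by
    have h : Filter.Tendsto (fun η : ℝ => (1 + η) * ((1 + η) * d + η + η) + η * C)
        (nhdsWithin 0 (Ioi 0)) (nhds ((1 + 0) * ((1 + 0) * d + 0 + 0) + 0 * C)) :=
      (Continuous.tendsto (by fun_prop) 0).mono_left nhdsWithin_le_nhds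
    obtain ⟨η, h1, h2⟩ := ((h.eventually_lt_const (by simpa using hD)).and
      self_mem_nhdsWithin).exists
    exact ⟨η, h2, h1⟩
  obtain ⟨h, hhm, hh⟩ := exists_countable_dense_estimators (EuclideanSpace ℝ A)
    (EuclideanSpace ℝ (Aᶜ : Finset ι))
  set f : Matrix A A ℝ → ℝ≥0∞ := fun τ₁ => ⨅ k, estimationError A (h k) (condLaw A κ τ₁)
  have hfm : Measurable f := by
    refine Measurable.iInf fun k => Measurable.lintegral_kernel (κ := gaussianKernel ∘ₖ κ) ?_
    exact (((measurable_sub _).sub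
      ((hhm k).comp (measurable_sub _))).norm.pow_const 2).ennreal_ofReal
  have hf : ∀ τ₁ ∈ marginalSet Θ A,
      f τ₁ ≤ ENNReal.ofReal (1 + η) * dminBayesAt A κ τ₁ + ENNReal.ofReal η := fun τ₁ hτ₁ => by
    obtain ⟨m, hm, hmle⟩ := exists_estimationError_le A (condLaw A κ τ₁)
    have hmC := hmle.trans (hat τ₁ hτ₁)
    obtain ⟨k, hk⟩ := exists_estimationError_le_of_dense hh hhm (condLaw A κ τ₁)
      (ne_top_of_le_ne_top ENNReal.ofReal_ne_top (hmom τ₁ hτ₁)) hm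
      (ne_top_of_le_ne_top ENNReal.ofReal_ne_top hmC) hη
    refine (iInf_le _ k).trans (hk.trans ?_)
    gcongr
    exact hmle
  have hftop : ∀ τ₁ ∈ marginalSet Θ A, f τ₁ ≠ ∞ := fun τ₁ hτ₁ =>
    ne_top_of_le_ne_top (by finiteness [ne_top_of_le_ne_top ENNReal.ofReal_ne_top (hat τ₁ hτ₁)])
      (hf τ₁ hτ₁)
  have hfint : ∫⁻ τ₁, f τ₁ ∂(marginalPrior ν A) ≤ ENNReal.ofReal ((1 + η) * d + η) := by
    calc _ ≤ ∫⁻ τ₁, (ENNReal.ofReal (1 + η) * dminBayesAt A κ τ₁ + ENNReal.ofReal η)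
          ∂(marginalPrior ν A) := by
          refine lintegral_mono_ae ?_
          filter_upwards [hae] with τ₁ hτ₁ using hf τ₁ hτ₁
      _ = _ := by
          -- Splitting off constants on the right avoids any measurability of `dminBayesAt` in `τ₁`.
          rw [lintegral_add_right _ measurable_const,
            lintegral_const_mul' _ _ ENNReal.ofReal_ne_top,
            ENNReal.ofReal_add (p := (1 + η) * d) (by positivity) hη.le,
            ENNReal.ofReal_mul (p := 1 + η) (by positivity), hd,
            dminBayes, ENNReal.ofReal_toReal hfin]
          simp
  have hftr : ∫ τ₁, (f τ₁).toReal ∂(marginalPrior ν A) ≤ (1 + η) * d + η := by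
    rw [integral_toReal hfm.aemeasurable
      (by filter_upwards [hae] with τ₁ hτ₁ using (hftop τ₁ hτ₁).lt_top)]
    exact ENNReal.toReal_le_of_le_ofReal (by positivity) hfint
  have hfi : Integrable (fun τ₁ => (f τ₁).toReal) (marginalPrior ν A) :=
    integrable_toReal_of_lintegral_ne_top hfm.aemeasurable
      (ne_top_of_le_ne_top ENNReal.ofReal_ne_top hfint)
  have hfη : Integrable (fun τ₁ => (f τ₁).toReal + η) (marginalPrior ν A) :=
    hfi.add (integrable_const η)
  obtain ⟨Q, hQ⟩ := exists_quantizer (E := EuclideanSpace ℝ ι) hη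
  refine ne_top_of_le_ne_top (finiteRange_bound_ne_top Q.range) (usrdfBayes_le
    (δ := fun τ₁ => (1 + η) * ((f τ₁).toReal + η) + η * C) ?_ (fun τ₁ => ?_) ?_ ?_
    fun τ₁ hτ₁ => ?_)
  · exact ((hfm.ennreal_toReal.add_const η).const_mul _).add_const _
  · positivity
  · exact (hfη.const_mul _).add (integrable_const _)
  · rw [integral_add (hfη.const_mul _) (integrable_const _),
      integral_const_mul, integral_add hfi (integrable_const η)]
    simp only [integral_const, probReal_univ, smul_eq_mul, one_mul]
    refine le_trans ?_ hηD.le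
    gcongr
  · have hlt : f τ₁ < ENNReal.ofReal ((f τ₁).toReal + η) := by
      conv_lhs => rw [← ENNReal.ofReal_toReal (hftop τ₁ hτ₁)]
      exact (ENNReal.ofReal_lt_ofReal_iff (by positivity)).2 (lt_add_of_pos_right _ hη)
    obtain ⟨k, hk⟩ := iInf_lt_iff.1 hlt
    have := Measure.isProbabilityMeasure_map (μ := condLaw A κ τ₁) (measurable_sub A).aemeasurable
    rw [rhoBayes_eq_channelRDf]
    refine channelRDf_le_of_quantizer A _ _ Q (Kernel.deterministic (h k) (hhm k)) ?_
    rintro _ rfl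
    refine meanDistortion_quantizedKernel_le_ofReal hη hQ (by positivity) hC0 ?_ (hmom τ₁ hτ₁)
    refine le_trans (le_of_eq (lintegral_congr fun x => ?_)) hk.le
    rw [Kernel.lintegral_deterministic' _ (by fun_prop)]

/-- Near-optimal families are mixed pointwise: the mean budget is linear, and each `τ₁` inherits
convexity of `rhoBayes`. Families are nonnegative by definition, so `x` and `y` need no sign. -/
theorem usrdfBayes_convex {x y s t : ℝ} (hs : 0 < s) (ht : 0 < t) (hst : s + t = 1) :
    usrdfBayes Θ ν A κ (s * x + t * y) ≤
      ENNReal.ofReal s * usrdfBayes Θ ν A κ x + ENNReal.ofReal t * usrdfBayes Θ ν A κ y := by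
  have hs' : ENNReal.ofReal s ≠ 0 := by simpa using hs
  have ht' : ENNReal.ofReal t ≠ 0 := by simpa using ht
  refine le_mul_add_mul_of_forall_lt (by simp) (by simp) hs' ht' fun u v hu hv => ?_
  obtain ⟨δ₀, ⟨hm₀, hn₀, hi₀, hd₀⟩, hlt₀⟩ := exists_mem_lt_of_biInf_lt hu
  obtain ⟨δ₁, ⟨hm₁, hn₁, hi₁, hd₁⟩, hlt₁⟩ := exists_mem_lt_of_biInf_lt hv
  refine usrdfBayes_le (δ := fun τ₁ => s * δ₀ τ₁ + t * δ₁ τ₁)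
    ((hm₀.const_mul s).add (hm₁.const_mul t)) (fun τ₁ => ?_)
    ((hi₀.const_mul s).add (hi₁.const_mul t)) ?_ fun τ₁ hτ₁ => ?_
  · have := hn₀ τ₁
    have := hn₁ τ₁
    positivity
  · rw [integral_add (hi₀.const_mul s) (hi₁.const_mul t), integral_const_mul, integral_const_mul]
    gcongr
  · have := Measure.isProbabilityMeasure_map (μ := condLaw A κ τ₁) (measurable_sub A).aemeasurable
    have hle : ∀ δ : Matrix A A ℝ → ℝ, rhoBayes A κ (δ τ₁) τ₁ ≤
        ⨆ τ₁ ∈ marginalSet Θ A, rhoBayes A κ (δ τ₁) τ₁ := fun δ =>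
      le_iSup₂ (f := fun τ₁ (_ : τ₁ ∈ marginalSet Θ A) => rhoBayes A κ (δ τ₁) τ₁) τ₁ hτ₁
    calc _ ≤ ENNReal.ofReal s * rhoBayes A κ (δ₀ τ₁) τ₁ +
          ENNReal.ofReal t * rhoBayes A κ (δ₁ τ₁) τ₁ := by
          simp only [rhoBayes_eq_channelRDf]
          refine channelRDf_convex _ _ _ ?_ (hn₀ τ₁) (hn₁ τ₁) hs ht hst
          rintro _ rfl
          infer_instance
      _ ≤ _ := by
          gcongr
          exacts [(hle δ₀).trans hlt₀.le, (hle δ₁).trans hlt₁.le]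

theorem isRateDistortionShaped_usrdfBayes [IsProbabilityMeasure ν] (hΘ : IsCompact Θ) (hpos : ∀ τ ∈ Θ, τ.PosDef)
    (hν : ν Θᶜ = 0) (hκ : ∀ τ₁ ∈ marginalSet Θ A, κ τ₁ (atom Θ A τ₁)ᶜ = 0) (b : ℝ) :
    IsRateDistortionShaped (usrdfBayes Θ ν A κ) (dminBayes ν A κ) b :=
  IsRateDistortionShaped.of_Ioi b (fun _ hD => usrdfBayes_ne_top hΘ hpos hν hκ hD)
    usrdfBayes_antitone fun _ _ _ _ _ _ hs ht hst => usrdfBayes_convex hs ht hst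

end Bayes

end

end SampledGaussian

theorem lemma1 {m : ℕ} {Ω : Type*} [MeasurableSpace Ω] :
    -- known covariance matrix
    (∀ S : Matrix (Fin m) (Fin m) ℝ, S.PosDef →
      ∀ A : Finset (Fin m), A.Nonempty →
      SampledGaussian.IsRateDistortionShaped (SampledGaussian.srdfGMMS S A)
        (SampledGaussian.dminGMMS S A) S.trace) ∧
    -- Gaussian field on the unit interval
    (∀ (P : MeasureTheory.Measure Ω) [MeasureTheory.IsProbabilityMeasure P]
      (X : unitInterval → Ω → ℝ), SampledGaussian.IsGaussianField X P →
      ∀ A : Finset unitInterval, A.Nonempty →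
      SampledGaussian.IsRateDistortionShaped (SampledGaussian.srdfGMF X P A)
        (SampledGaussian.dminGMF X P A) (SampledGaussian.dmaxGMF X P)) ∧
    -- Bayesian universal setting
    (∀ Θ : Set (Matrix (Fin m) (Fin m) ℝ), IsCompact Θ → (∀ τ ∈ Θ, τ.PosDef) →
      ∀ (ν : MeasureTheory.Measure (Matrix (Fin m) (Fin m) ℝ))
        [MeasureTheory.IsProbabilityMeasure ν], ν Θᶜ = 0 →
      ∀ A : Finset (Fin m), A.Nonempty →
      ∀ (κ : ProbabilityTheory.Kernel (Matrix A A ℝ) (Matrix (Fin m) (Fin m) ℝ))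
        [ProbabilityTheory.IsMarkovKernel κ], SampledGaussian.IsPosterior Θ ν A κ →
      SampledGaussian.IsRateDistortionShaped (SampledGaussian.usrdfBayes Θ ν A κ)
        (SampledGaussian.dminBayes ν A κ) (SampledGaussian.dmaxBayes ν)) ∧
    -- nonBayesian universal setting
    (∀ Θ : Set (Matrix (Fin m) (Fin m) ℝ), Θ.Nonempty → IsCompact Θ → (∀ τ ∈ Θ, τ.PosDef) →
      ∀ A : Finset (Fin m), A.Nonempty →
      SampledGaussian.IsRateDistortionShaped (SampledGaussian.usrdfNonBayes Θ A)
        (SampledGaussian.dminNonBayes Θ A) (SampledGaussian.dmaxNonBayes Θ)) := by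
  refine ⟨fun S _ A _ => SampledGaussian.isRateDistortionShaped_srdfGMMS S A _,
    fun P _ X hX A _ => SampledGaussian.isRateDistortionShaped_srdfGMF hX A _,
    fun Θ hΘ hpos ν _ hν A _ κ _ hκ => ?_, fun Θ _ hΘ hpos A _ => ?_⟩
  · exact SampledGaussian.isRateDistortionShaped_usrdfBayes hΘ hpos hν hκ.carried _
  · exact SampledGaussian.isRateDistortionShaped_usrdfNonBayes hΘ hpos _
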